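/- Let $\hbar>0$. On $L^2(\mathbb R)$ consider, for $\ell_g>0$, the Gaussian position-dephasing channel $$\Delta_g(\rho)=\int_{\mathbb R}\tilde g(p)\,e^{ip\hat X/\hbar}\rho\,e^{-ip\hat X/\hbar}\,dp,\qquad \tilde g(p)=\frac{1}{\sqrt{2\pi}\,\eta}e^{-p^2/2\eta^2},\quad \eta=\hbar/\ell_g,$$ and the $l_2$ dephasing loss $C_2^g(\rho)=\|\rho\|_2^2-\|\Delta_g(\rho)\|_2^2$, where $\|\cdot\|_2$ is the Hilbert–Schmidt norm. A Gaussian wavepacket of width $\sigma>0$ is $$\psi(x)=(2\pi\sigma^2)^{-1/4}\exp\!\Big[-\tfrac{(x-c)^2}{4\sigma^2}+i\big(\alpha(x-c)^2+\beta(x-c)+\gamma\big)\Big],\qquad c,\alpha,\beta,\gamma\in\mathbb R.$$ (i) In position representation $\Delta_g$ multiplies the kernel by $g(x-y)$ with $g(\xi)=e^{-\xi^2/2\ell_g^2}$: for all $\psi,\varphi\in L^2(\mathbb R)$ and almost every $x$, $(\Delta_g(|\psi\rangle\langle\psi|)\varphi)(x)=\int g(x-y)\,\psi(x)\overline{\psi(y)}\,\varphi(y)\,dy$.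 (ii) For every Gaussian wavepacket of width $\sigma$ (in particular for $\alpha=\beta=\gamma=0$), $$C_2^g(|\psi\rangle\langle\psi|)=1-\frac1{\sqrt{1+4\sigma^2/\ell_g^2}}.$$ (iii) This value is strictly increasing in $\sigma/\ell_g$, tends to $0$ as $\sigma/\ell_g\to0$ and to $1$ as $\sigma/\ell_g\to\infty$. (iv) Let $G,m,M,x_0,\sigma_0>0$, let $V(x)=-GmM/x$, let $V_2$ be its second-order Taylor polynomial at $x_0$, and let $\kappa=\sqrt{2GM/x_0^3}$. There is exactly one family $(\psi_t)_{t\in\mathbb R}$ of unit vectors of $L^2(\mathbb R)$ that solves $i\hbar\,\partial_t\psi=-\frac{\hbar^2}{2m}\partial_x^2\psi+V_2\psi$ weakly (tested against Schwartz functions of $x$) with $\psi_0(x)=(2\pi\sigma_0^2)^{-1/4}e^{-(x-x_0)^2/4\sigma_0^2}$. For every $t$, $\psi_t$ is a Gaussian wavepacket centred at the classical position $x_0-\frac{x_0}{2}(\cosh\kappa t-1)$ with width $\sigma_t$, $$\sigma_t^2=\sigma_0^2\cosh^2(\kappa t)+\Big(\frac{\hbar}{2m\sigma_0\kappa}\Big)^2\sinh^2(\kappa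 t),$$ and for every $\ell_g>0$ $$C_2^g(|\psi_t\rangle\langle\psi_t|)=1-\frac{1}{\sqrt{1+4\sigma_t^2/\ell_g^2}},$$ which is strictly increasing in $t\ge0$. -/

import Mathlib

open MeasureTheory Filter Topology Set
open scoped ENNReal NNReal ComplexConjugate SchwartzMap InnerProductSpace

noncomputable section

section HilbertSchmidt

variable {H : Type*} [NormedAddCommGroup H] [InnerProductSpace ℂ H] [CompleteSpace H]

/-- The squared Hilbert–Schmidt norm `‖A‖₂² = ∑ᵢ ‖A bᵢ‖²`, as an extended nonnegative number, for a
Hilbert basis `b` chosen once and for all; see `hsNormSq_eq` for independence of the basis. -/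
def hsNormSq (A : H →L[ℂ] H) : ℝ≥0∞ :=
  ∑' i, ‖A ((exists_hilbertBasis ℂ H).choose_spec.choose i)‖ₑ ^ 2

theorem HilbertBasis.enorm_sq_eq_tsum {ι : Type*} (b : HilbertBasis ι ℂ H) (x : H) :
    ‖x‖ₑ ^ 2 = ∑' i, ‖⟪b i, x⟫_ℂ‖ₑ ^ 2 := by
  have h := b.hasSum_inner_mul_inner x x
  have h2 : HasSum (fun i => ‖⟪b i, x⟫_ℂ‖ ^ 2) (‖x‖ ^ 2) := by
    have h3 := Complex.hasSum_re h
    rw [inner_self_eq_norm_sq_to_K] at h3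
    convert h3 using 1
    · funext i
      rw [← inner_conj_symm x (b i), ← Complex.normSq_eq_conj_mul_self, Complex.ofReal_re,
        Complex.normSq_eq_norm_sq]
    · norm_cast
  have h4 := ENNReal.ofReal_tsum_of_nonneg (fun i => sq_nonneg (‖⟪b i, x⟫_ℂ‖)) h2.summable
  rw [h2.tsum_eq, ENNReal.ofReal_pow (norm_nonneg _), ofReal_norm] at h4
  rw [h4]
  congr 1
  funext i
  rw [ENNReal.ofReal_pow (norm_nonneg _), ofReal_norm]

theorem tsum_enorm_sq_eq_adjoint {ι κ : Type*} (b : HilbertBasis ι ℂ H) (c : HilbertBasis κ ℂ H)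
    (A : H →L[ℂ] H) :
    ∑' i, ‖A (b i)‖ₑ ^ 2 = ∑' k, ‖ContinuousLinearMap.adjoint A (c k)‖ₑ ^ 2 := by
  simp_rw [c.enorm_sq_eq_tsum (A _), b.enorm_sq_eq_tsum (ContinuousLinearMap.adjoint A _)]
  rw [ENNReal.tsum_comm]
  congr! 4 with k i
  rw [ContinuousLinearMap.adjoint_inner_right, ← ofReal_norm, ← ofReal_norm, norm_inner_symm]

/-- The Hilbert–Schmidt norm may be computed in any Hilbert basis. -/
theorem hsNormSq_eq {ι : Type*} (b : HilbertBasis ι ℂ H) (A : H →L[ℂ] H) :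
    hsNormSq A = ∑' i, ‖A (b i)‖ₑ ^ 2 := by
  rw [hsNormSq, tsum_enorm_sq_eq_adjoint _ b, ← tsum_enorm_sq_eq_adjoint b b]

/-- The pure state `|ψ⟩⟨ψ|`. -/
def pureState (ψ : H) : H →L[ℂ] H := InnerProductSpace.rankOne ℂ ψ ψ

/-- The `l₂` dephasing loss `‖ρ‖₂² - ‖Δ ρ‖₂²` of the state `ρ` under the map `Δ`. -/
def l2DephasingLoss (Δ : (H →L[ℂ] H) → (H →L[ℂ] H)) (ρ : H →L[ℂ] H) : ℝ :=
  (hsNormSq ρ).toReal - (hsNormSq (Δ ρ)).toReal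

end HilbertSchmidt

/-- The Hilbert space `L²(ℝ, ℂ)` of a particle on the line. -/
abbrev LineHilbert : Type := Lp ℂ 2 (volume : Measure ℝ)

/-- The function `x ↦ exp(i p x / ħ)`. -/
def kickPhase (hbar p : ℝ) (x : ℝ) : ℂ := Complex.exp (Complex.I * (p / hbar * x : ℝ))

theorem memLp_kickPhase (hbar p : ℝ) : MemLp (kickPhase hbar p) ∞ (volume : Measure ℝ) := by
  refine memLp_top_of_bound (C := 1) ?_ (ae_of_all _ fun x => ?_)
  · exact (by unfold kickPhase; fun_prop : Continuous (kickPhase hbar p)).aestronglyMeasurable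
  · rw [kickPhase, mul_comm, Complex.norm_exp_ofReal_mul_I]

/-- The momentum kick `exp(i p X / ħ)`: multiplication by `exp(i p x / ħ)` on `L²(ℝ)`. -/
def momentumKick (hbar p : ℝ) : LineHilbert →L[ℂ] LineHilbert :=
  (ContinuousLinearMap.mul ℂ ℂ).holderL volume ∞ 2 2 ((memLp_kickPhase hbar p).toLp)

theorem momentumKick_coe (hbar p : ℝ) (φ : LineHilbert) :
    momentumKick hbar p φ =ᵐ[volume] fun x => kickPhase hbar p x * φ x := by
  rw [momentumKick, ContinuousLinearMap.holderL_apply_apply]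
  filter_upwards [(ContinuousLinearMap.mul ℂ ℂ).coeFn_holder (r := 2)
    ((memLp_kickPhase hbar p).toLp) φ, (memLp_kickPhase hbar p).coeFn_toLp] with x h1 h2
  rw [h1, h2, ContinuousLinearMap.mul_apply']

/-- The random momentum kick channel `ρ ↦ ∫ w(p) exp(ipX/ħ) ρ exp(-ipX/ħ) dp` with kick density `w`
(a Bochner integral in operator norm; the integrand is norm continuous for compact `ρ`, in
particular for every state). -/
def randomKickChannel (hbar : ℝ) (w : ℝ → ℝ) (ρ : LineHilbert →L[ℂ] LineHilbert) :
    LineHilbert →L[ℂ] LineHilbert :=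
  ∫ p : ℝ, (w p : ℂ) •
    (momentumKick hbar p ∘L ρ ∘L ContinuousLinearMap.adjoint (momentumKick hbar p))

/-- Centred Gaussian density with standard deviation `η`. -/
def gaussianKickDensity (η : ℝ) (p : ℝ) : ℝ :=
  1 / (√(2 * Real.pi) * η) * Real.exp (-p ^ 2 / (2 * η ^ 2))

/-- The Gaussian dephasing kernel `g(ξ) = exp(-ξ² / (2 ℓ²))` with coherence length `ℓ`. -/
def gaussianKernel (ℓ : ℝ) (ξ : ℝ) : ℝ := Real.exp (-ξ ^ 2 / (2 * ℓ ^ 2))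

/-- The Gaussian dephasing channel with coherence length `ℓ`: random momentum kicks with Gaussian
density of momentum spread `η = ħ / ℓ`. -/
def gaussianDephasing (hbar ℓ : ℝ) :
    (LineHilbert →L[ℂ] LineHilbert) → (LineHilbert →L[ℂ] LineHilbert) :=
  randomKickChannel hbar (gaussianKickDensity (hbar / ℓ))

/-- The Gaussian wavefunction of width `σ` centred at `c`, with phase
`α (x - c)² + β (x - c) + γ`. -/
def gaussianWave (σ c α β γ : ℝ) (x : ℝ) : ℂ :=
  ((1 / (2 * Real.pi * σ ^ 2) ^ (1 / 4 : ℝ) * Real.exp (-(x - c) ^ 2 / (4 * σ ^ 2)) : ℝ) : ℂ) *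
    Complex.exp (Complex.I * (α * (x - c) ^ 2 + β * (x - c) + γ : ℝ))

theorem memLp_gaussianWave (σ c α β γ : ℝ) :
    MemLp (gaussianWave σ c α β γ) 2 (volume : Measure ℝ) := by
  have hc : Continuous (gaussianWave σ c α β γ) := by unfold gaussianWave; fun_prop
  rw [memLp_two_iff_integrable_sq_norm hc.aestronglyMeasurable]
  rcases eq_or_ne σ 0 with rfl | hσ
  · simp [gaussianWave]
  have h := ((integrable_exp_neg_mul_sq (b := 1 / (2 * σ ^ 2)) (by positivity)).comp_sub_right
    c).const_mul ((1 / (2 * Real.pi * σ ^ 2) ^ (1 / 4 : ℝ)) ^ 2)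
  refine h.congr (ae_of_all _ fun x => ?_)
  simp only [gaussianWave]
  rw [norm_mul, mul_comm Complex.I, Complex.norm_exp_ofReal_mul_I, mul_one, Complex.norm_real,
    Real.norm_eq_abs, sq_abs, mul_pow, ← Real.exp_nat_mul]
  congr 2
  push_cast
  field_simp
  ring

/-- The Gaussian wavepacket as a vector of `L²(ℝ)`. -/
def gaussianPacket (σ c α β γ : ℝ) : LineHilbert := (memLp_gaussianWave σ c α β γ).toLp

/-- The Hamiltonian `-(ħ²/2m) d²/dx² + V(x)` acting on Schwartz functions. -/
def hamiltonian (hbar m : ℝ) (V : ℝ → ℝ) (φ : 𝓢(ℝ, ℂ)) (x : ℝ) : ℂ :=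
  -(hbar ^ 2 / (2 * m) : ℝ) * deriv (deriv φ) x + (V x : ℂ) * φ x

/-- `ψ` is a trajectory of normalized states that solves the Schrödinger equation
`iħ ∂ₜψ = -(ħ²/2m) ∂ₓ²ψ + Vψ` weakly, that is, tested against Schwartz functions in space. -/
structure IsSchrodingerEvolution (hbar m : ℝ) (V : ℝ → ℝ) (ψ : ℝ → LineHilbert) : Prop where
  norm_eq_one : ∀ t, ‖ψ t‖ = 1
  hasDerivAt : ∀ (φ : 𝓢(ℝ, ℂ)) (t : ℝ),
    HasDerivAt (fun s => ∫ x, conj (φ x) * ψ s x)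
      (-(Complex.I / hbar) * ∫ x, conj (hamiltonian hbar m V φ x) * ψ t x) t

/-- The Newtonian potential energy `-G m M / x`. -/
def newtonPotential (G m M : ℝ) (x : ℝ) : ℝ := -(G * m * M / x)

/-- Second order Taylor polynomial of `V` at `x₀`. -/
def quadraticApprox (V : ℝ → ℝ) (x₀ x : ℝ) : ℝ :=
  V x₀ + deriv V x₀ * (x - x₀) + 1 / 2 * deriv (deriv V) x₀ * (x - x₀) ^ 2

/-- The rate `κ = √(2GM/x₀³)`. -/
def newtonRate (G M x₀ : ℝ) : ℝ := √(2 * G * M / x₀ ^ 3)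

/-- The width `σₜ` of the packet, with
`σₜ² = σ₀² cosh²(κt) + (ħ/(2mσ₀κ))² sinh²(κt)`. -/
def newtonWidth (hbar G m M x₀ σ₀ t : ℝ) : ℝ :=
  √(σ₀ ^ 2 * Real.cosh (newtonRate G M x₀ * t) ^ 2 +
    (hbar / (2 * m * σ₀ * newtonRate G M x₀)) ^ 2 * Real.sinh (newtonRate G M x₀ * t) ^ 2)

/-- The classical trajectory in the quadratic potential that starts at rest at `x₀`, that is, the
solution of `q'' = -GM/x₀² + κ² (q - x₀)`; it equals `x₀ - GM/(2x₀²) t² + O(t⁴)`. -/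
def newtonCenter (G M x₀ t : ℝ) : ℝ := x₀ - x₀ / 2 * (Real.cosh (newtonRate G M x₀ * t) - 1)

end

/-! A momentum kick turns `|ψ⟩⟨ψ|` into the rank-one operator of the kicked vector, whose kernel
carries the extra phase `exp(ip(x - y)/ħ)`. Averaging over `p` replaces the phase by the Fourier
transform of the kick density, which for `η = ħ/ℓ` is `exp(-(x - y)²/2ℓ²)`; this is
`gaussianDephasing_pureState_apply`. The Hilbert–Schmidt norm is the `L²` norm of the kernel
(`hsNormSq_eq_lintegral_kernel`), so the norm after dephasing is a double integral of `|ψ(x)|²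
|ψ(y)|² exp(-(x - y)²/ℓ²)`. Centre and phase of a packet drop out, and two Gaussian integrals give
the loss, from which monotonicity and limits are read off.

For the dynamics, completing the square turns the Taylor polynomial into an inverted oscillator with
vertex at `3x₀/2`. On `exp(a y² + b y + d)`, with `y` the distance from the vertex, the Schrödinger
equation becomes a Riccati equation for `a` and equations for `b` and `d` driven by it. All are
solved through `u = cosh κt + i r sinh κt`, and the width is `σ₀ |u|`. Dominated convergence makes
these pointwise solutions differentiable in `L²`.

Uniqueness of weak solutions is by duality and needs no propagator. The overlap of a weak solution
with a strong Gaussian solution is constant in time (`hasDerivAt_inner`). The Gaussian solutions can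
be made to pass at time `T` through `exp(a y² + iξy)` for every real `ξ`, a family that is total by
injectivity of the Fourier transform. Hence the state at time `0` determines the state at `T`. -/

/-! ### Dominated convergence in `L²` and strong continuity of the kicks -/

theorem norm_toLp_two_sq {f : ℝ → ℂ} (hf : MemLp f 2 (volume : Measure ℝ)) :
    ‖hf.toLp‖ ^ 2 = ∫ x, ‖f x‖ ^ 2 := by
  rw [← @inner_self_eq_norm_sq ℂ, L2.inner_def]
  simp only [inner_self_eq_norm_sq_to_K]
  norm_cast
  refine integral_congr_ae ?_
  filter_upwards [hf.coeFn_toLp] with x hx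
  rw [hx]

theorem inner_toLp_left {f : ℝ → ℂ} (hf : MemLp f 2 (volume : Measure ℝ)) (φ : LineHilbert) :
    ⟪hf.toLp, φ⟫_ℂ = ∫ x, conj (f x) * φ x := by
  rw [L2.inner_def]
  refine integral_congr_ae ?_
  filter_upwards [hf.coeFn_toLp] with x hx
  rw [hx, RCLike.inner_apply, mul_comm]

/-- Dominated convergence for `‖F i x‖ ^ 2`, dominated by `bound ^ 2`. It serves both the continuity
of the kicks and the differentiation of Gaussians in `L²`. -/
theorem tendsto_toLp_zero_of_dominated {ι : Type*} {l : Filter ι} [l.IsCountablyGenerated]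
    {F : ι → ℝ → ℂ} (hF : ∀ i, MemLp (F i) 2 (volume : Measure ℝ)) {bound : ℝ → ℝ}
    (hbound : MemLp bound 2 (volume : Measure ℝ))
    (hle : ∀ᶠ i in l, ∀ᵐ x, ‖F i x‖ ≤ bound x)
    (hlim : ∀ᵐ x, Tendsto (fun i => F i x) l (𝓝 0)) :
    Tendsto (fun i => (hF i).toLp) l (𝓝 0) := by
  have h : Tendsto (fun i => ∫ x, ‖F i x‖ ^ 2) l (𝓝 (∫ _ : ℝ, (0 : ℝ))) := by
    refine tendsto_integral_filter_of_dominated_convergence (fun x => bound x ^ 2)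
      (.of_forall fun i => ((hF i).1.norm.pow 2)) ?_ hbound.integrable_sq ?_
    · filter_upwards [hle] with i hi
      filter_upwards [hi] with x hx
      rw [Real.norm_eq_abs, abs_of_nonneg (by positivity)]
      gcongr
    · filter_upwards [hlim] with x hx
      simpa using (hx.norm.pow 2)
  simp only [← norm_toLp_two_sq (hF _), integral_zero] at h
  rw [tendsto_zero_iff_norm_tendsto_zero]
  simpa using h.sqrt

theorem norm_kickPhase (hbar p x : ℝ) : ‖kickPhase hbar p x‖ = 1 := by
  rw [kickPhase, mul_comm, Complex.norm_exp_ofReal_mul_I]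

theorem norm_momentumKick (hbar p : ℝ) (φ : LineHilbert) : ‖momentumKick hbar p φ‖ = ‖φ‖ := by
  rw [Lp.norm_def, Lp.norm_def]
  congr 1
  refine eLpNorm_congr_norm_ae ?_
  filter_upwards [momentumKick_coe hbar p φ] with x hx
  rw [hx, norm_mul, norm_kickPhase, one_mul]

/-- Strong continuity suffices for the channel: the rank-one operators built from the kicked vector
are then continuous in operator norm. -/
theorem continuous_momentumKick (hbar : ℝ) (φ : LineHilbert) :
    Continuous (fun p => momentumKick hbar p φ) := by
  rw [continuous_iff_continuousAt]
  intro p₀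
  have hF (p : ℝ) : MemLp (fun x => (kickPhase hbar p x - kickPhase hbar p₀ x) * φ x) 2
      (volume : Measure ℝ) := by
    refine (MemLp.congr_norm (Lp.memLp (momentumKick hbar p φ - momentumKick hbar p₀ φ)) ?_ ?_)
    · refine AEStronglyMeasurable.mul (Continuous.aestronglyMeasurable ?_) (Lp.aestronglyMeasurable φ)
      unfold kickPhase
      fun_prop
    · filter_upwards [Lp.coeFn_sub (momentumKick hbar p φ) (momentumKick hbar p₀ φ),
        momentumKick_coe hbar p φ, momentumKick_coe hbar p₀ φ] with x h1 h2 h3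
      rw [h1, Pi.sub_apply, h2, h3, sub_mul]
  have heq (p : ℝ) : (hF p).toLp = momentumKick hbar p φ - momentumKick hbar p₀ φ := by
    ext1
    filter_upwards [Lp.coeFn_sub (momentumKick hbar p φ) (momentumKick hbar p₀ φ),
        momentumKick_coe hbar p φ, momentumKick_coe hbar p₀ φ, (hF p).coeFn_toLp] with x h1 h2 h3 h4
    rw [h1, Pi.sub_apply, h2, h3, h4, sub_mul]
  have := tendsto_toLp_zero_of_dominated (l := 𝓝 p₀) hF ((Lp.memLp φ).norm.const_mul 2)
    (.of_forall fun p => .of_forall fun x => ?_) (.of_forall fun x => ?_)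
  · simp only [heq] at this
    exact tendsto_sub_nhds_zero_iff.mp this
  · rw [norm_mul]
    gcongr
    calc _ ≤ ‖kickPhase hbar p x‖ + ‖kickPhase hbar p₀ x‖ := norm_sub_le _ _
      _ = 2 := by rw [norm_kickPhase, norm_kickPhase]; norm_num
  · have hc : Continuous (fun p => (kickPhase hbar p x - kickPhase hbar p₀ x) * φ x) := by
      unfold kickPhase
      fun_prop
    simpa using hc.tendsto p₀

/-! ### The position kernel of the dephased pure state -/

/-- The operator-valued integrand has norm `|w p| ‖ψ‖²`, hence is Bochner integrable, and the
integral commutes with evaluation at `φ`. -/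
theorem randomKickChannel_pureState_apply (hbar : ℝ) {w : ℝ → ℝ} (hw : Integrable w)
    (ψ φ : LineHilbert) :
    randomKickChannel hbar w (pureState ψ) φ =
      ∫ p : ℝ, ((w p : ℂ) * ⟪momentumKick hbar p ψ, φ⟫_ℂ) • momentumKick hbar p ψ := by
  have heq (p : ℝ) : momentumKick hbar p ∘L pureState ψ ∘L
      ContinuousLinearMap.adjoint (momentumKick hbar p) =
      InnerProductSpace.rankOne ℂ (momentumKick hbar p ψ) (momentumKick hbar p ψ) := by
    rw [pureState, InnerProductSpace.rankOne_comp, InnerProductSpace.comp_rankOne,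
      ContinuousLinearMap.adjoint_adjoint]
  have hcont : Continuous fun p => InnerProductSpace.rankOne ℂ (momentumKick hbar p ψ)
      (momentumKick hbar p ψ) := by
    have hψ := continuous_momentumKick hbar ψ
    exact ((ContinuousLinearMap.smulRightL ℂ LineHilbert LineHilbert).continuous.comp
      ((innerSL ℂ).continuous.comp hψ)).clm_apply hψ
  have hint : Integrable fun p : ℝ => (w p : ℂ) •
      InnerProductSpace.rankOne ℂ (momentumKick hbar p ψ) (momentumKick hbar p ψ) := by
    refine (hw.norm.mul_const (‖ψ‖ * ‖ψ‖)).mono'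
      (AEStronglyMeasurable.fun_smul hw.ofReal.aestronglyMeasurable hcont.aestronglyMeasurable)
      (.of_forall fun p => ?_)
    rw [norm_smul, InnerProductSpace.norm_rankOne, norm_momentumKick, Complex.norm_real]
  simp only [randomKickChannel, heq]
  rw [ContinuousLinearMap.integral_apply hint]
  simp only [_root_.smul_apply, InnerProductSpace.rankOne_apply, smul_smul]

/-- Multiplication of a product of integrable functions by the Fourier transform of `w` in the
difference variable. -/
theorem integral_kickPhase_mul_integral (hbar : ℝ) {w : ℝ → ℝ} (hw : Integrable w) {F G : ℝ → ℂ}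
    (hF : Integrable F) (hG : Integrable G) :
    ∫ p : ℝ, (w p : ℂ) * ((∫ x, kickPhase hbar p x * F x) * ∫ y, kickPhase hbar p (-y) * G y) =
      ∫ x, F x * ∫ y, (∫ p : ℝ, (w p : ℂ) * kickPhase hbar p (x - y)) * G y := by
  have hFG := hF.mul_prod hG
  -- The phase has modulus one, so integrability of `w`, `F` and `G` already licenses Fubini.
  have hint : Integrable (fun q : ℝ × ℝ × ℝ => kickPhase hbar q.1 (q.2.1 - q.2.2) *
      ((w q.1 : ℂ) * (F q.2.1 * G q.2.2))) (volume.prod (volume.prod volume)) := by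
    refine (hw.ofReal.mul_prod hFG).bdd_mul (c := 1) ?_ (.of_forall fun q => ?_)
    · refine Continuous.aestronglyMeasurable ?_
      unfold kickPhase
      fun_prop
    · rw [norm_kickPhase]
  have hphase (p x y : ℝ) :
      kickPhase hbar p (x - y) = kickPhase hbar p x * kickPhase hbar p (-y) := by
    rw [kickPhase, kickPhase, kickPhase, ← Complex.exp_add]
    congr 1
    push_cast
    ring
  calc
    _ = ∫ p : ℝ, ∫ q : ℝ × ℝ, kickPhase hbar p (q.1 - q.2) * ((w p : ℂ) * (F q.1 * G q.2)) := by
      refine integral_congr_ae (.of_forall fun p => ?_)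
      dsimp only
      rw [← integral_prod_mul, ← integral_const_mul]
      refine integral_congr_ae (.of_forall fun q => ?_)
      simp only [hphase]
      ring
    _ = ∫ q : ℝ × ℝ, ∫ p : ℝ, kickPhase hbar p (q.1 - q.2) * ((w p : ℂ) * (F q.1 * G q.2)) :=
      integral_integral_swap hint
    _ = ∫ q : ℝ × ℝ, F q.1 * ((∫ p : ℝ, (w p : ℂ) * kickPhase hbar p (q.1 - q.2)) * G q.2) := by
      refine integral_congr_ae (.of_forall fun q => ?_)
      dsimp only
      rw [← integral_mul_const, ← integral_const_mul]
      refine integral_congr_ae (.of_forall fun p => ?_)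
      ring
    _ = _ := by
      rw [Measure.volume_eq_prod, integral_prod]
      · simp only [integral_const_mul]
      · refine hint.integral_prod_right.congr (.of_forall fun q => ?_)
        dsimp only
        rw [← integral_mul_const, ← integral_const_mul]
        refine integral_congr_ae (.of_forall fun p => ?_)
        ring

theorem integrable_conj_mul (f g : LineHilbert) : Integrable (fun x => conj (f x) * g x) := by
  refine (L2.integrable_inner (𝕜 := ℂ) f g).congr (.of_forall fun x => ?_)
  simp only [RCLike.inner_apply, mul_comm]

theorem integrable_gaussianKickDensity {η : ℝ} (hη : 0 < η) :
    Integrable (gaussianKickDensity η) := by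
  refine ((integrable_exp_neg_mul_sq (b := 1 / (2 * η ^ 2)) (by positivity)).const_mul
    (1 / (√(2 * Real.pi) * η))).congr (.of_forall fun p => ?_)
  simp only [gaussianKickDensity]
  congr 2
  ring

theorem integral_gaussianKickDensity_mul_kickPhase {hbar ℓ : ℝ} (hhbar : 0 < hbar) (hℓ : 0 < ℓ)
    (ξ : ℝ) :
    ∫ p : ℝ, (gaussianKickDensity (hbar / ℓ) p : ℂ) * kickPhase hbar p ξ = gaussianKernel ℓ ξ := by
  set η := hbar / ℓ with hη
  have hη0 : 0 < η := by positivity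
  have hb : 0 < ((1 / (2 * η ^ 2) : ℝ) : ℂ).re := by
    rw [Complex.ofReal_re]
    positivity
  have h := fourierIntegral_gaussian hb ((ξ / hbar : ℝ) : ℂ)
  have hN : ((Real.pi : ℂ) / ((1 / (2 * η ^ 2) : ℝ) : ℂ)) ^ (1 / 2 : ℂ) =
      ((√(2 * Real.pi) * η : ℝ) : ℂ) := by
    rw [← Complex.ofReal_div, show (1 / 2 : ℂ) = ((1 / 2 : ℝ) : ℂ) by norm_num,
      ← Complex.ofReal_cpow (by positivity), ← Real.sqrt_eq_rpow]
    congr 1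
    rw [show Real.pi / (1 / (2 * η ^ 2)) = 2 * Real.pi * η ^ 2 by field_simp,
      Real.sqrt_mul (by positivity), Real.sqrt_sq hη0.le]
  calc
    _ = ∫ p : ℝ, ((1 / (√(2 * Real.pi) * η) : ℝ) : ℂ) *
        (Complex.exp (Complex.I * ((ξ / hbar : ℝ) : ℂ) * p) *
          Complex.exp (-((1 / (2 * η ^ 2) : ℝ) : ℂ) * p ^ 2)) := by
      refine integral_congr_ae (.of_forall fun p => ?_)
      simp only [gaussianKickDensity, kickPhase, Complex.ofReal_mul, Complex.ofReal_exp]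
      rw [mul_assoc, mul_comm (Complex.exp _)]
      congr 3
      · push_cast
        ring
      · push_cast
        ring
    _ = _ := by
      rw [integral_const_mul, h, hN, ← mul_assoc, ← Complex.ofReal_mul,
        one_div_mul_cancel (by positivity), Complex.ofReal_one, one_mul, gaussianKernel,
        Complex.ofReal_exp]
      congr 1
      rw [hη]
      push_cast
      have h1 : (hbar : ℂ) ≠ 0 := by exact_mod_cast hhbar.ne'
      have h2 : (ℓ : ℂ) ≠ 0 := by exact_mod_cast hℓ.ne'
      field_simp
      ring

theorem gaussianKernel_le_one (ℓ ξ : ℝ) : gaussianKernel ℓ ξ ≤ 1 := by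
  rw [gaussianKernel, Real.exp_le_one_iff]
  exact div_nonpos_of_nonpos_of_nonneg (neg_nonpos.mpr (sq_nonneg _)) (by positivity)

theorem continuous_gaussianKernel (ℓ : ℝ) : Continuous (gaussianKernel ℓ) := by
  unfold gaussianKernel
  fun_prop

theorem norm_gaussianKernel_le (ℓ ξ : ℝ) : ‖(gaussianKernel ℓ ξ : ℂ)‖ ≤ 1 := by
  rw [Complex.norm_real, Real.norm_eq_abs, abs_of_nonneg (by exact Real.exp_nonneg _)]
  exact gaussianKernel_le_one ℓ ξ

theorem norm_integral_gaussianKernel_mul_le (ℓ : ℝ) {G : ℝ → ℂ} (hG : Integrable G) (x : ℝ) :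
    ‖∫ y, (gaussianKernel ℓ (x - y) : ℂ) * G y‖ ≤ ∫ y, ‖G y‖ := by
  refine norm_integral_le_of_norm_le hG.norm (.of_forall fun y => ?_)
  rw [norm_mul]
  exact mul_le_of_le_one_left (norm_nonneg _) (norm_gaussianKernel_le _ _)

theorem continuous_integral_gaussianKernel_mul (ℓ : ℝ) {G : ℝ → ℂ} (hG : Integrable G) :
    Continuous fun x => ∫ y, (gaussianKernel ℓ (x - y) : ℂ) * G y := by
  have hc := continuous_gaussianKernel ℓ
  refine continuous_of_dominated (bound := fun y => ‖G y‖) (fun x => ?_)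
    (fun x => .of_forall fun y => ?_) hG.norm (.of_forall fun y => ?_)
  · exact AEStronglyMeasurable.fun_mul (Continuous.aestronglyMeasurable (by fun_prop)) hG.1
  · rw [norm_mul]
    exact mul_le_of_le_one_left (norm_nonneg _) (norm_gaussianKernel_le _ _)
  · fun_prop

/-- Both sides are `L²` vectors, the right one because `K` is bounded, so they may be compared by
pairing with an arbitrary `f`. The phases of the two overlaps combine into one in `x - y`, and
Fubini leaves the Fourier transform of the density. -/
theorem gaussianDephasing_pureState_apply {hbar ℓ : ℝ} (hhbar : 0 < hbar) (hℓ : 0 < ℓ)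
    (ψ φ : LineHilbert) :
    gaussianDephasing hbar ℓ (pureState ψ) φ =ᵐ[volume]
      fun x => ∫ y, (gaussianKernel ℓ (x - y) : ℂ) * (ψ x * conj (ψ y)) * φ y := by
  have hw := integrable_gaussianKickDensity (η := hbar / ℓ) (by positivity)
  have hG := integrable_conj_mul ψ φ
  set K : ℝ → ℂ := fun x => ∫ y, (gaussianKernel ℓ (x - y) : ℂ) * (conj (ψ y) * φ y) with hK
  have hKmem : MemLp (fun x => K x * ψ x) 2 (volume : Measure ℝ) := by
    refine MemLp.of_le_mul (c := ∫ y, ‖conj (ψ y) * φ y‖) (Lp.memLp ψ) ?_ (.of_forall fun x => ?_)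
    · exact (continuous_integral_gaussianKernel_mul ℓ hG).aestronglyMeasurable.mul
        (Lp.aestronglyMeasurable ψ)
    · rw [norm_mul]
      gcongr
      exact norm_integral_gaussianKernel_mul_le ℓ hG x
  have hfun : (fun x => ∫ y, (gaussianKernel ℓ (x - y) : ℂ) * (ψ x * conj (ψ y)) * φ y) =
      fun x => K x * ψ x := by
    funext x
    rw [hK, ← integral_mul_const]
    congr 1
    funext y
    ring
  rw [hfun]
  suffices h : gaussianDephasing hbar ℓ (pureState ψ) φ = hKmem.toLp by
    rw [h]
    exact hKmem.coeFn_toLp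
  refine ext_inner_left ℂ fun f => ?_
  rw [gaussianDephasing, randomKickChannel_pureState_apply hbar hw, ← integral_inner]
  swap
  · have hc := continuous_momentumKick hbar ψ
    refine (hw.norm.mul_const (‖ψ‖ * ‖φ‖ * ‖ψ‖)).mono' ?_ (.of_forall fun p => ?_)
    · exact (hw.ofReal.aestronglyMeasurable.mul
        (hc.inner (𝕜 := ℂ) continuous_const).aestronglyMeasurable).smul hc.aestronglyMeasurable
    · rw [norm_smul, norm_mul, norm_momentumKick, Complex.norm_real, mul_assoc]
      gcongr
      exact (norm_inner_le_norm _ _).trans_eq (by rw [norm_momentumKick])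
  have hF := integrable_conj_mul f ψ
  have h1 (p : ℝ) : ⟪f, momentumKick hbar p ψ⟫_ℂ =
      ∫ x, kickPhase hbar p x * (conj (f x) * ψ x) := by
    rw [L2.inner_def]
    refine integral_congr_ae ?_
    filter_upwards [momentumKick_coe hbar p ψ] with x hx
    rw [hx, RCLike.inner_apply]
    ring
  have h2 (p : ℝ) : ⟪momentumKick hbar p ψ, φ⟫_ℂ =
      ∫ y, kickPhase hbar p (-y) * (conj (ψ y) * φ y) := by
    rw [L2.inner_def]
    refine integral_congr_ae ?_
    filter_upwards [momentumKick_coe hbar p ψ] with x hx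
    have hconj : conj (kickPhase hbar p x) = kickPhase hbar p (-x) := by
      rw [kickPhase, kickPhase, ← Complex.exp_conj]
      simp
    rw [hx, RCLike.inner_apply, map_mul, hconj]
    ring
  have h3 : ⟪f, hKmem.toLp⟫_ℂ = ∫ x, (conj (f x) * ψ x) * K x := by
    rw [L2.inner_def]
    refine integral_congr_ae ?_
    filter_upwards [hKmem.coeFn_toLp] with x hx
    rw [hx, RCLike.inner_apply]
    ring
  rw [h3, hK]
  simp only [← integral_gaussianKickDensity_mul_kickPhase hhbar hℓ]
  rw [← integral_kickPhase_mul_integral hbar hw hF hG]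
  refine integral_congr_ae (.of_forall fun p => ?_)
  simp only [inner_smul_right]
  rw [h1, h2]
  ring

/-! ### Hilbert–Schmidt norms -/

/-- Distinct orthonormal vectors lie at distance `√2 > 1`, so balls of radius `1/2` around them are
disjoint. Countability is what allows almost-everywhere identities to hold for all basis vectors at
once. -/
theorem Orthonormal.countable_index {H ι : Type*} [NormedAddCommGroup H] [InnerProductSpace ℂ H]
    [TopologicalSpace.SeparableSpace H] {v : ι → H} (hv : Orthonormal ℂ v) : Countable ι := by
  rw [← countable_univ_iff]
  refine PairwiseDisjoint.countable_of_isOpen (s := fun i => Metric.ball (v i) (1 / 2)) ?_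
    (fun i _ => Metric.isOpen_ball) (fun i _ => ⟨v i, Metric.mem_ball_self (by norm_num)⟩)
  intro i _ j _ hij
  refine Metric.ball_disjoint_ball ?_
  have h : ‖v i - v j‖ ^ 2 = 2 := by
    rw [@norm_sub_sq ℂ, hv.1 i, hv.1 j, hv.2 hij]
    norm_num
  rw [dist_eq_norm]
  nlinarith [norm_nonneg (v i - v j)]

theorem enorm_toLp_two_sq {f : ℝ → ℂ} (hf : MemLp f 2 (volume : Measure ℝ)) :
    ‖hf.toLp‖ₑ ^ 2 = ∫⁻ x, ‖f x‖ₑ ^ 2 := by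
  rw [Lp.enorm_toLp, eLpNorm_eq_lintegral_rpow_enorm_toReal (by norm_num) (by norm_num),
    ← ENNReal.rpow_natCast, ← ENNReal.rpow_mul]
  simp

/-- The Hilbert–Schmidt norm of an integral operator is the `L²` norm of its kernel. -/
theorem hsNormSq_eq_lintegral_kernel {A : LineHilbert →L[ℂ] LineHilbert} {k : ℝ → ℝ → ℂ}
    (hk : ∀ x, MemLp (k x) 2 (volume : Measure ℝ))
    (hA : ∀ φ : LineHilbert, A φ =ᵐ[volume] fun x => ∫ y, k x y * φ y) :
    hsNormSq A = ∫⁻ x, ∫⁻ y, ‖k x y‖ₑ ^ 2 := by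
  obtain ⟨s, b, -⟩ := exists_hilbertBasis ℂ LineHilbert
  have : Fact ((2 : ℝ≥0∞) ≠ ∞) := ⟨by norm_num⟩
  have : Countable s := b.orthonormal.countable_index
  have hk' (x : ℝ) : MemLp (fun y => conj (k x y)) 2 (volume : Measure ℝ) := (hk x).star
  have h1 (i : s) : ‖A (b i)‖ₑ ^ 2 = ∫⁻ x, ‖A (b i) x‖ₑ ^ 2 := by
    rw [← enorm_toLp_two_sq (Lp.memLp (A (b i))), Lp.toLp_coeFn]
  -- Up to conjugation, `A (b i) x` is a coefficient of the conjugated row `k x`; Parseval in `y`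
  -- then sums over `i`.
  have h2 (i : s) : (fun x => ‖A (b i) x‖ₑ ^ 2) =ᵐ[volume]
      fun x => ‖⟪b i, (hk' x).toLp⟫_ℂ‖ₑ ^ 2 := by
    filter_upwards [hA (b i)] with x hx
    rw [hx, ← ofReal_norm, ← ofReal_norm, norm_inner_symm, inner_toLp_left]
    simp
  calc
    hsNormSq A = ∑' i, ∫⁻ x, ‖A (b i) x‖ₑ ^ 2 := by
      rw [hsNormSq_eq b]
      simp only [h1]
    _ = ∫⁻ x, ∑' i, ‖A (b i) x‖ₑ ^ 2 := by
      rw [lintegral_tsum fun i => ((Lp.aestronglyMeasurable (A (b i))).enorm.pow_const 2)]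
    _ = ∫⁻ x, ∑' i, ‖⟪b i, (hk' x).toLp⟫_ℂ‖ₑ ^ 2 := by
      refine lintegral_congr_ae ?_
      filter_upwards [ae_all_iff.mpr h2] with x hx
      simp only [hx]
    _ = _ := by
      simp only [← b.enorm_sq_eq_tsum, enorm_toLp_two_sq, RCLike.enorm_conj]

theorem hsNormSq_pureState {H : Type*} [NormedAddCommGroup H] [InnerProductSpace ℂ H]
    [CompleteSpace H] (ψ : H) : hsNormSq (pureState ψ) = ‖ψ‖ₑ ^ 4 := by
  obtain ⟨s, b, -⟩ := exists_hilbertBasis ℂ H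
  rw [hsNormSq_eq b]
  have h (i : s) : ‖pureState ψ (b i)‖ₑ ^ 2 = ‖⟪b i, ψ⟫_ℂ‖ₑ ^ 2 * ‖ψ‖ₑ ^ 2 := by
    rw [pureState, InnerProductSpace.rankOne_apply, enorm_smul, mul_pow, ← ofReal_norm,
      norm_inner_symm, ofReal_norm]
  simp only [h]
  rw [ENNReal.tsum_mul_right, ← b.enorm_sq_eq_tsum]
  ring

/-! ### Gaussian integrals and the value of the loss -/

theorem lintegral_exp_neg_mul_sub_sq {b : ℝ} (hb : 0 < b) (d : ℝ) :
    ∫⁻ y : ℝ, ENNReal.ofReal (Real.exp (-b * (y - d) ^ 2)) =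
      ENNReal.ofReal (√(Real.pi / b)) := by
  rw [← ofReal_integral_eq_lintegral_ofReal
    ((integrable_exp_neg_mul_sq hb).comp_sub_right d) (.of_forall fun _ => Real.exp_nonneg _),
    integral_sub_right_eq_self fun y => Real.exp (-b * y ^ 2), integral_gaussian]

/-- The convolution of two Gaussians. -/
theorem lintegral_exp_mul_exp {a b : ℝ} (ha : 0 < a) (hb : 0 < b) (c x : ℝ) :
    ∫⁻ y : ℝ, ENNReal.ofReal (Real.exp (-a * (x - y) ^ 2) * Real.exp (-b * (y - c) ^ 2)) =
      ENNReal.ofReal (√(Real.pi / (a + b)) * Real.exp (-(a * b / (a + b)) * (x - c) ^ 2)) := by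
  have hab : a + b ≠ 0 := by positivity
  -- Completing the square in `y` around the weighted mean of `x` and `c`.
  have h (y : ℝ) : Real.exp (-a * (x - y) ^ 2) * Real.exp (-b * (y - c) ^ 2) =
      Real.exp (-(a * b / (a + b)) * (x - c) ^ 2) *
        Real.exp (-(a + b) * (y - (a * x + b * c) / (a + b)) ^ 2) := by
    rw [← Real.exp_add, ← Real.exp_add]
    congr 1
    field_simp
    ring
  simp only [h, ENNReal.ofReal_mul (Real.exp_nonneg _)]
  rw [lintegral_const_mul' _ _ ENNReal.ofReal_ne_top, lintegral_exp_neg_mul_sub_sq (by positivity),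
    ENNReal.ofReal_mul (Real.sqrt_nonneg _), mul_comm]

theorem norm_gaussianWave_sq {σ : ℝ} (hσ : 0 < σ) (c α β γ x : ℝ) :
    ‖gaussianWave σ c α β γ x‖ ^ 2 =
      1 / √(2 * Real.pi * σ ^ 2) * Real.exp (-(1 / (2 * σ ^ 2)) * (x - c) ^ 2) := by
  rw [gaussianWave, norm_mul, mul_comm Complex.I, Complex.norm_exp_ofReal_mul_I, mul_one,
    Complex.norm_real, Real.norm_eq_abs, sq_abs, mul_pow, ← Real.exp_nat_mul, div_pow, one_pow,
    ← Real.rpow_natCast, ← Real.rpow_mul (by positivity), Real.sqrt_eq_rpow]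
  congr 2
  · norm_num
  · push_cast
    field_simp
    ring

theorem enorm_gaussianWave_sq {σ : ℝ} (hσ : 0 < σ) (c α β γ x : ℝ) :
    ‖gaussianWave σ c α β γ x‖ₑ ^ 2 =
      ENNReal.ofReal (1 / √(2 * Real.pi * σ ^ 2)) *
        ENNReal.ofReal (Real.exp (-(1 / (2 * σ ^ 2)) * (x - c) ^ 2)) := by
  rw [← ENNReal.ofReal_mul (by positivity), ← norm_gaussianWave_sq hσ c α β γ,
    ENNReal.ofReal_pow (norm_nonneg _), ofReal_norm]

theorem enorm_gaussianPacket {σ : ℝ} (hσ : 0 < σ) (c α β γ : ℝ) :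
    ‖gaussianPacket σ c α β γ‖ₑ = 1 := by
  have h : ‖gaussianPacket σ c α β γ‖ₑ ^ 2 = 1 := by
    rw [gaussianPacket, enorm_toLp_two_sq]
    simp only [enorm_gaussianWave_sq hσ]
    rw [lintegral_const_mul' _ _ ENNReal.ofReal_ne_top,
      lintegral_exp_neg_mul_sub_sq (by positivity), ← ENNReal.ofReal_mul (by positivity),
      show Real.pi / (1 / (2 * σ ^ 2)) = 2 * Real.pi * σ ^ 2 by field_simp,
      one_div_mul_cancel (by positivity), ENNReal.ofReal_one]
  have h2 : ‖gaussianPacket σ c α β γ‖ = 1 := by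
    rw [← pow_eq_one_iff_of_nonneg (norm_nonneg _) two_ne_zero,
      ← toReal_enorm, ← ENNReal.toReal_pow, h, ENNReal.toReal_one]
  rw [← ofReal_norm, h2, ENNReal.ofReal_one]

theorem norm_gaussianPacket {σ : ℝ} (hσ : 0 < σ) (c α β γ : ℝ) :
    ‖gaussianPacket σ c α β γ‖ = 1 := by
  rw [← toReal_enorm, enorm_gaussianPacket hσ, ENNReal.toReal_one]

theorem hsNormSq_gaussianDephasing_pureState {hbar ℓ : ℝ} (hhbar : 0 < hbar) (hℓ : 0 < ℓ)
    (ψ : LineHilbert) :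
    hsNormSq (gaussianDephasing hbar ℓ (pureState ψ)) =
      ∫⁻ x, ‖ψ x‖ₑ ^ 2 *
        ∫⁻ y, ENNReal.ofReal (Real.exp (-(1 / ℓ ^ 2) * (x - y) ^ 2)) * ‖ψ y‖ₑ ^ 2 := by
  have hc := continuous_gaussianKernel ℓ
  rw [hsNormSq_eq_lintegral_kernel
    (k := fun x y => (gaussianKernel ℓ (x - y) : ℂ) * (ψ x * conj (ψ y))) (fun x => ?_)
    (gaussianDephasing_pureState_apply hhbar hℓ ψ)]
  · refine lintegral_congr fun x => ?_
    rw [← lintegral_const_mul' _ _ (by finiteness)]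
    refine lintegral_congr fun y => ?_
    have hg : ‖(gaussianKernel ℓ (x - y) : ℂ)‖ₑ ^ 2 =
        ENNReal.ofReal (Real.exp (-(1 / ℓ ^ 2) * (x - y) ^ 2)) := by
      rw [← ofReal_norm, ← ENNReal.ofReal_pow (norm_nonneg _), Complex.norm_real,
        Real.norm_eq_abs, sq_abs, gaussianKernel, ← Real.exp_nat_mul]
      congr 2
      push_cast
      field_simp
    rw [enorm_mul, enorm_mul, mul_pow, mul_pow, hg, RCLike.enorm_conj]
    ring
  · refine MemLp.of_le_mul (c := ‖ψ x‖) (Lp.memLp ψ) ?_ (.of_forall fun y => ?_)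
    · exact (Continuous.aestronglyMeasurable (by fun_prop)).mul
        ((Lp.memLp ψ).star.aestronglyMeasurable.const_mul _)
    · rw [norm_mul, norm_mul, RCLike.norm_conj]
      exact mul_le_of_le_one_left (by positivity) (norm_gaussianKernel_le _ _)

theorem l2DephasingLoss_gaussianPacket {hbar ℓ σ : ℝ} (hhbar : 0 < hbar) (hℓ : 0 < ℓ) (hσ : 0 < σ)
    (c α β γ : ℝ) :
    l2DephasingLoss (gaussianDephasing hbar ℓ) (pureState (gaussianPacket σ c α β γ)) =
      1 - 1 / √(1 + 4 * σ ^ 2 / ℓ ^ 2) := by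
  have hae : gaussianPacket σ c α β γ =ᵐ[volume] gaussianWave σ c α β γ :=
    (memLp_gaussianWave σ c α β γ).coeFn_toLp
  set a := 1 / ℓ ^ 2 with ha
  set b := 1 / (2 * σ ^ 2) with hb
  set N := 1 / √(2 * Real.pi * σ ^ 2) with hN
  have ha0 : 0 < a := by positivity
  have hb0 : 0 < b := by positivity
  have hN0 : 0 < N := by positivity
  -- The inner integral is a convolution with rate `ab/(a + b)` in `x - c`; multiplied by the
  -- density of rate `b`, it leaves a single Gaussian integral.
  have hin (x : ℝ) : ∫⁻ y, ENNReal.ofReal (Real.exp (-a * (x - y) ^ 2)) *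
      ‖gaussianPacket σ c α β γ y‖ₑ ^ 2 = ENNReal.ofReal (N * (√(Real.pi / (a + b)) *
        Real.exp (-(a * b / (a + b)) * (x - c) ^ 2))) := by
    rw [ENNReal.ofReal_mul hN0.le, ← lintegral_exp_mul_exp ha0 hb0,
      ← lintegral_const_mul' _ _ ENNReal.ofReal_ne_top]
    refine lintegral_congr_ae ?_
    filter_upwards [hae] with y hy
    rw [hy, enorm_gaussianWave_sq hσ, ENNReal.ofReal_mul (Real.exp_nonneg _)]
    ring
  have hout : hsNormSq (gaussianDephasing hbar ℓ (pureState (gaussianPacket σ c α β γ))) =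
      ENNReal.ofReal (N ^ 2 * √(Real.pi / (a + b)) * √(Real.pi / (a * b / (a + b) + b))) := by
    rw [hsNormSq_gaussianDephasing_pureState hhbar hℓ, ENNReal.ofReal_mul (by positivity),
      ← lintegral_exp_neg_mul_sub_sq (by positivity) c,
      ← lintegral_const_mul' _ _ ENNReal.ofReal_ne_top]
    refine lintegral_congr_ae ?_
    filter_upwards [hae] with x hx
    rw [hin, hx, enorm_gaussianWave_sq hσ, ← ENNReal.ofReal_mul hN0.le,
      ← ENNReal.ofReal_mul (by positivity), ← ENNReal.ofReal_mul (by positivity), neg_add, add_mul,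
      Real.exp_add]
    congr 1
    ring
  have hval : N ^ 2 * √(Real.pi / (a + b)) * √(Real.pi / (a * b / (a + b) + b)) =
      1 / √(1 + 4 * σ ^ 2 / ℓ ^ 2) := by
    rw [hN, div_pow, Real.sq_sqrt (by positivity), mul_assoc, ← Real.sqrt_mul (by positivity),
      show Real.pi / (a + b) * (Real.pi / (a * b / (a + b) + b)) =
        (2 * Real.pi * σ ^ 2) ^ 2 / (1 + 4 * σ ^ 2 / ℓ ^ 2) by
          rw [ha, hb]
          field_simp
          ring,
      Real.sqrt_div (by positivity), Real.sqrt_sq (by positivity)]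
    field_simp
  rw [l2DephasingLoss, hsNormSq_pureState, enorm_gaussianPacket hσ, hout, hval,
    ENNReal.toReal_ofReal (by positivity)]
  simp

theorem gaussianLoss_lt {r s : ℝ} (hr : 0 ≤ r) (hrs : r < s) :
    1 - 1 / √(1 + 4 * r) < 1 - 1 / √(1 + 4 * s) := by
  gcongr

theorem tendsto_gaussianLoss_zero {u : ℕ → ℝ} (hu : Tendsto u atTop (𝓝 0)) :
    Tendsto (fun n => 1 - 1 / √(1 + 4 * u n ^ 2)) atTop (𝓝 0) := by
  have hc : ContinuousAt (fun r : ℝ => 1 - 1 / √(1 + 4 * r ^ 2)) 0 := by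
    have : √(1 + 4 * (0 : ℝ) ^ 2) ≠ 0 := by norm_num
    fun_prop (disch := assumption)
  have := hc.tendsto.comp hu
  simpa [Function.comp_def] using this

theorem tendsto_gaussianLoss_one {u : ℕ → ℝ} (hu : Tendsto u atTop atTop) :
    Tendsto (fun n => 1 - 1 / √(1 + 4 * u n ^ 2)) atTop (𝓝 1) := by
  have h1 : Tendsto (fun n => 1 + 4 * u n ^ 2) atTop atTop :=
    tendsto_atTop_add_const_left _ _
      (((tendsto_pow_atTop two_ne_zero).comp hu).const_mul_atTop (by norm_num))
  have h2 := (Real.tendsto_sqrt_atTop.comp h1).inv_tendsto_atTop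
  simpa [Function.comp_def] using h2.const_sub 1

/-! ### Polynomials times Gaussians as Schwartz functions -/

theorem Polynomial.exists_norm_eval_le_exp (P : Polynomial ℂ) :
    ∃ M : ℝ, ∀ x : ℝ, ‖P.eval (x : ℂ)‖ ≤ M * Real.exp |x| := by
  induction P using Polynomial.induction_on' with
  | add p q hp hq =>
    obtain ⟨M, hM⟩ := hp
    obtain ⟨N, hN⟩ := hq
    refine ⟨M + N, fun x => ?_⟩
    rw [Polynomial.eval_add, add_mul]
    exact (norm_add_le _ _).trans (add_le_add (hM x) (hN x))
  | monomial n a =>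
    refine ⟨‖a‖ * n.factorial, fun x => ?_⟩
    have h := Real.pow_div_factorial_le_exp |x| (abs_nonneg x) n
    rw [div_le_iff₀ (by positivity)] at h
    rw [Polynomial.eval_monomial, norm_mul, norm_pow, Complex.norm_real, Real.norm_eq_abs,
      mul_assoc, mul_comm (n.factorial : ℝ)]
    gcongr

/-- The function `P(x) exp(Q(x))` of a real variable. -/
noncomputable def polyExp (P Q : Polynomial ℂ) (x : ℝ) : ℂ :=
  P.eval (x : ℂ) * Complex.exp (Q.eval (x : ℂ))

theorem hasDerivAt_polyExp (P Q : Polynomial ℂ) (x : ℝ) :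
    HasDerivAt (polyExp P Q) (polyExp (P.derivative + P * Q.derivative) Q x) x := by
  have hP := (P.hasDerivAt (x : ℂ)).comp_ofReal
  have hQ := (Q.hasDerivAt (x : ℂ)).comp_ofReal
  refine (hP.mul hQ.cexp).congr_deriv ?_
  simp only [polyExp, Polynomial.eval_add, Polynomial.eval_mul]
  ring

theorem deriv_polyExp (P Q : Polynomial ℂ) :
    deriv (polyExp P Q) = polyExp (P.derivative + P * Q.derivative) Q :=
  funext fun x => (hasDerivAt_polyExp P Q x).deriv

theorem contDiff_polyExp (P Q : Polynomial ℂ) : ContDiff ℝ (⊤ : ℕ∞) (polyExp P Q) := by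
  have h (R : Polynomial ℂ) : ContDiff ℝ (⊤ : ℕ∞) fun x : ℝ => R.eval (x : ℂ) := by
    have h1 : ContDiff ℂ (⊤ : ℕ∞) fun z : ℂ => R.eval z := by
      simpa only [Polynomial.coe_aeval_eq_eval] using R.contDiff_aeval (𝕜 := ℂ) (⊤ : ℕ∞)
    exact (h1.restrict_scalars ℝ).comp Complex.ofRealCLM.contDiff
  exact (h P).mul (h Q).cexp

theorem exists_iteratedDeriv_polyExp (P Q : Polynomial ℂ) (n : ℕ) :
    ∃ R : Polynomial ℂ, iteratedDeriv n (polyExp P Q) = polyExp R Q := by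
  induction n with
  | zero => exact ⟨P, iteratedDeriv_zero⟩
  | succ n ih =>
    obtain ⟨R, hR⟩ := ih
    exact ⟨_, by rw [iteratedDeriv_succ, hR, deriv_polyExp]⟩

/-- The polynomial is at most a multiple of `exp |x|`, and `|x| ≤ δ x² + 1/(4δ)` lets the quadratic
decay absorb it. -/
theorem exists_norm_polyExp_le (P : Polynomial ℂ) {Q : Polynomial ℂ} {δ K : ℝ} (hδ : 0 < δ)
    (hQ : ∀ x : ℝ, (Q.eval (x : ℂ)).re ≤ K - δ * x ^ 2) : ∃ M, ∀ x, ‖polyExp P Q x‖ ≤ M := by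
  obtain ⟨M, hM⟩ := P.exists_norm_eval_le_exp
  have hM0 : 0 ≤ M := by simpa using (norm_nonneg _).trans (hM 0)
  refine ⟨M * Real.exp (K + 1 / (4 * δ)), fun x => ?_⟩
  rw [polyExp, norm_mul, Complex.norm_exp]
  calc
    _ ≤ M * Real.exp |x| * Real.exp (K - δ * x ^ 2) := by
      gcongr
      exacts [hM x, hQ x]
    _ ≤ _ := by
      rw [mul_assoc, ← Real.exp_add]
      refine mul_le_mul_of_nonneg_left (Real.exp_le_exp.mpr ?_) hM0
      have h : |x| ≤ δ * x ^ 2 + 1 / (4 * δ) := by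
        rw [← sub_nonneg, ← sq_abs x,
          show δ * |x| ^ 2 + 1 / (4 * δ) - |x| = δ * (|x| - 1 / (2 * δ)) ^ 2 by field_simp; ring]
        positivity
      linarith

/-- `P(x) exp(Q(x))` as a Schwartz function, for `Q` with quadratic decay. -/
noncomputable def schwartzPolyExp (P Q : Polynomial ℂ)
    (hQ : ∃ δ K : ℝ, 0 < δ ∧ ∀ x : ℝ, (Q.eval (x : ℂ)).re ≤ K - δ * x ^ 2) : 𝓢(ℝ, ℂ) where
  toFun := polyExp P Q
  smooth' := contDiff_polyExp P Q
  decay' k n := by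
    obtain ⟨R, hR⟩ := exists_iteratedDeriv_polyExp P Q n
    obtain ⟨δ, K, hδ, h⟩ := hQ
    obtain ⟨M, hM⟩ := exists_norm_polyExp_le (Polynomial.X ^ k * R) hδ h
    refine ⟨M, fun x => ?_⟩
    rw [norm_iteratedFDeriv_eq_norm_iteratedDeriv, hR]
    refine le_of_eq_of_le ?_ (hM x)
    simp [polyExp, mul_assoc]

theorem coe_schwartzPolyExp (P Q : Polynomial ℂ)
    (hQ : ∃ δ K : ℝ, 0 < δ ∧ ∀ x : ℝ, (Q.eval (x : ℂ)).re ≤ K - δ * x ^ 2) :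
    ⇑(schwartzPolyExp P Q hQ) = polyExp P Q := rfl

/-- The polynomial `a (x - c)² + b (x - c) + d`. -/
noncomputable def quadPoly (c : ℝ) (a b d : ℂ) : Polynomial ℂ :=
  .C a * (.X - .C (c : ℂ)) ^ 2 + .C b * (.X - .C (c : ℂ)) + .C d

theorem eval_quadPoly (c : ℝ) (a b d : ℂ) (x : ℝ) :
    (quadPoly c a b d).eval (x : ℂ) = a * (x - c) ^ 2 + b * (x - c) + d := by
  simp [quadPoly]

theorem re_eval_quadPoly (c : ℝ) (a b d : ℂ) (x : ℝ) :
    ((quadPoly c a b d).eval (x : ℂ)).re = a.re * (x - c) ^ 2 + b.re * (x - c) + d.re := by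
  rw [eval_quadPoly, ← Complex.ofReal_sub, ← Complex.ofReal_pow, Complex.add_re, Complex.add_re,
    Complex.re_mul_ofReal, Complex.re_mul_ofReal]

theorem exists_re_quadPoly_le (c : ℝ) {a : ℂ} (ha : a.re < 0) (b d : ℂ) :
    ∃ δ K : ℝ, 0 < δ ∧ ∀ x : ℝ, ((quadPoly c a b d).eval (x : ℂ)).re ≤ K - δ * x ^ 2 := by
  obtain ⟨r, hr, hra⟩ : ∃ r : ℝ, 0 < r ∧ a.re = -r := ⟨-a.re, by linarith, by ring⟩
  -- Half of `r (x - c)²` absorbs the linear term; the other half is at least `r x²/4 - r c²/2`.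
  refine ⟨r / 4, d.re + b.re ^ 2 / (2 * r) + r * c ^ 2 / 2, by positivity, fun x => ?_⟩
  rw [re_eval_quadPoly, hra, ← sub_nonneg,
    show d.re + b.re ^ 2 / (2 * r) + r * c ^ 2 / 2 - r / 4 * x ^ 2 -
      (-r * (x - c) ^ 2 + b.re * (x - c) + d.re) =
      r / 2 * ((x - c) - b.re / r) ^ 2 + r / 4 * (x - 2 * c) ^ 2 by field_simp; ring]
  positivity

/-- The Schwartz function `(p (x-c)² + q (x-c) + r) exp(a (x-c)² + b (x-c) + d)`. -/
noncomputable def gaussianSchwartz (c : ℝ) (p q r a b d : ℂ) (ha : a.re < 0) : 𝓢(ℝ, ℂ) :=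
  schwartzPolyExp (quadPoly c p q r) (quadPoly c a b d) (exists_re_quadPoly_le c ha b d)

theorem gaussianSchwartz_apply (c : ℝ) (p q r a b d : ℂ) (ha : a.re < 0) (x : ℝ) :
    gaussianSchwartz c p q r a b d ha x = (p * (x - c) ^ 2 + q * (x - c) + r) *
      Complex.exp (a * (x - c) ^ 2 + b * (x - c) + d) := by
  rw [gaussianSchwartz, coe_schwartzPolyExp, polyExp, eval_quadPoly, eval_quadPoly]

/-! ### Differentiating Gaussian families in `L²` -/

/-- The mean value inequality bounds the difference quotients by `bound`, so their distance to the
derivative is dominated by `2 * bound`. -/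
theorem hasDerivAt_toLp_of_dominated {f f' : ℝ → ℝ → ℂ}
    (hf : ∀ t, MemLp (f t) 2 (volume : Measure ℝ)) {t : ℝ}
    (hf' : MemLp (f' t) 2 (volume : Measure ℝ)) {bound : ℝ → ℝ}
    (hbound : MemLp bound 2 (volume : Measure ℝ))
    (hderiv : ∀ s x, HasDerivAt (fun s => f s x) (f' s x) s)
    (hle : ∀ s ∈ Metric.ball t 1, ∀ x, ‖f' s x‖ ≤ bound x) :
    HasDerivAt (fun s => (hf s).toLp) hf'.toLp t := by
  rw [hasDerivAt_iff_tendsto_slope_zero, ← tendsto_sub_nhds_zero_iff]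
  have hF (h : ℝ) : MemLp (fun x => h⁻¹ • (f (t + h) x - f t x) - f' t x) 2
      (volume : Measure ℝ) := (((hf (t + h)).sub (hf t)).const_smul h⁻¹).sub hf'
  have heq (h : ℝ) : h⁻¹ • ((hf (t + h)).toLp - (hf t).toLp) - hf'.toLp = (hF h).toLp := by
    rw [← MemLp.toLp_sub, ← MemLp.toLp_const_smul, ← MemLp.toLp_sub]
    rfl
  simp only [heq]
  refine tendsto_toLp_zero_of_dominated hF (hbound.const_mul 2) ?_ (.of_forall fun x => ?_)
  · filter_upwards [self_mem_nhdsWithin, nhdsWithin_le_nhds (Metric.ball_mem_nhds 0 one_pos)]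
      with h h0 h1
    refine .of_forall fun x => ?_
    have hball : t + h ∈ Metric.ball t 1 := by simpa using h1
    have hmv := (convex_ball t 1).norm_image_sub_le_of_norm_hasDerivWithin_le
      (fun s _ => (hderiv s x).hasDerivWithinAt) (fun s hs => hle s hs x)
      (Metric.mem_ball_self one_pos) hball
    rw [add_sub_cancel_left] at hmv
    have hn : ‖h⁻¹ • (f (t + h) x - f t x)‖ ≤ bound x := by
      rw [norm_smul, norm_inv, inv_mul_le_iff₀ (norm_pos_iff.mpr h0), mul_comm]
      exact hmv
    calc
      _ ≤ ‖h⁻¹ • (f (t + h) x - f t x)‖ + ‖f' t x‖ := norm_sub_le _ _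
      _ ≤ 2 * bound x := by
        linarith [hle t (Metric.mem_ball_self one_pos) x]
  · have h := (hasDerivAt_iff_tendsto_slope_zero.mp (hderiv t x)).sub_const (f' t x)
    rwa [sub_self] at h

theorem exp_abs_sub_sq_le {δ L : ℝ} (hδ : 0 < δ) (y : ℝ) :
    L * |y| - δ * y ^ 2 ≤ L ^ 2 / (2 * δ) - δ / 2 * y ^ 2 := by
  rw [← sub_nonneg, ← sq_abs y, show L ^ 2 / (2 * δ) - δ / 2 * |y| ^ 2 - (L * |y| - δ * |y| ^ 2) =
    δ / 2 * (|y| - L / δ) ^ 2 by field_simp; ring]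
  positivity

theorem one_add_abs_add_sq_le_exp (y : ℝ) : y ^ 2 + |y| + 1 ≤ 2 * Real.exp |y| := by
  have := Real.quadratic_le_exp_of_nonneg (abs_nonneg y)
  rw [← sq_abs y]
  nlinarith [abs_nonneg y]

/-- The bound sees the coefficients only through `δ` and `K`, so one Gaussian dominates a compact
range of times. The prefactor costs an `exp |y|`, hence `K + 1`. -/
theorem norm_gaussianSchwartz_le {c δ K : ℝ} (hδ : 0 < δ) {p q r a b d : ℂ} (ha : a.re < 0)
    (haδ : a.re ≤ -δ) (hb : ‖b‖ ≤ K) (hd : ‖d‖ ≤ K) (hp : ‖p‖ ≤ K) (hq : ‖q‖ ≤ K) (hr : ‖r‖ ≤ K)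
    (x : ℝ) :
    ‖gaussianSchwartz c p q r a b d ha x‖ ≤
      2 * K * Real.exp (K + (K + 1) ^ 2 / (2 * δ)) * Real.exp (-(δ / 2) * (x - c) ^ 2) := by
  have hK : 0 ≤ K := (norm_nonneg b).trans hb
  have hy : ‖((x : ℂ) - c)‖ = |x - c| := by
    rw [← Complex.ofReal_sub, Complex.norm_real, Real.norm_eq_abs]
  set y := x - c with hydef
  have h1 : ‖p * ((x : ℂ) - c) ^ 2 + q * (x - c) + r‖ ≤ K * (y ^ 2 + |y| + 1) := by
    calc
      _ ≤ ‖p * ((x : ℂ) - c) ^ 2‖ + ‖q * ((x : ℂ) - c)‖ + ‖r‖ := norm_add₃_le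
      _ = ‖p‖ * y ^ 2 + ‖q‖ * |y| + ‖r‖ := by
        rw [norm_mul, norm_mul, norm_pow, hy, sq_abs]
      _ ≤ K * y ^ 2 + K * |y| + K := by gcongr
      _ = _ := by ring
  have h2 : a.re * y ^ 2 + b.re * y + d.re ≤ K + K * |y| - δ * y ^ 2 := by
    have hby : b.re * y ≤ K * |y| := by
      refine (le_abs_self _).trans ?_
      rw [abs_mul]
      gcongr
      exact (Complex.abs_re_le_norm b).trans hb
    have hdr : d.re ≤ K := (Complex.re_le_norm d).trans hd
    nlinarith [sq_nonneg y]
  rw [gaussianSchwartz_apply, norm_mul, Complex.norm_exp, ← eval_quadPoly c a b d x,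
    re_eval_quadPoly]
  calc
    _ ≤ K * (2 * Real.exp |y|) * Real.exp (K + K * |y| - δ * y ^ 2) := by
      gcongr
      exact h1.trans (by gcongr; exact one_add_abs_add_sq_le_exp y)
    _ = 2 * K * Real.exp (K + ((K + 1) * |y| - δ * y ^ 2)) := by
      rw [show K + ((K + 1) * |y| - δ * y ^ 2) = |y| + (K + K * |y| - δ * y ^ 2) by ring,
        Real.exp_add |y|]
      ring
    _ ≤ _ := by
      rw [mul_assoc (2 * K), ← Real.exp_add]
      refine mul_le_mul_of_nonneg_left (Real.exp_le_exp.mpr ?_) (by positivity)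
      have := exp_abs_sub_sq_le (L := K + 1) hδ y
      linarith

theorem memLp_exp_neg_mul_sub_sq {b : ℝ} (hb : 0 < b) (c : ℝ) :
    MemLp (fun x : ℝ => Real.exp (-b * (x - c) ^ 2)) 2 (volume : Measure ℝ) := by
  rw [memLp_two_iff_integrable_sq (Continuous.aestronglyMeasurable (by fun_prop))]
  refine ((integrable_exp_neg_mul_sq (b := 2 * b) (by positivity)).comp_sub_right c).congr
    (.of_forall fun x => ?_)
  simp only
  rw [← Real.exp_nat_mul]
  congr 1
  push_cast
  ring

/-- A differentiable family of Gaussians is differentiable in `L²`. -/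
theorem hasDerivAt_gaussianSchwartz_toLp {c : ℝ} {a b d a' b' d' : ℝ → ℂ} (ha : ∀ t, (a t).re < 0)
    (hda : ∀ t, HasDerivAt a (a' t) t) (hdb : ∀ t, HasDerivAt b (b' t) t)
    (hdd : ∀ t, HasDerivAt d (d' t) t) (hca : Continuous a') (hcb : Continuous b')
    (hcd : Continuous d') (t : ℝ) :
    HasDerivAt (fun s => (gaussianSchwartz c 0 0 1 (a s) (b s) (d s) (ha s)).toLp 2 volume)
      ((gaussianSchwartz c (a' t) (b' t) (d' t) (a t) (b t) (d t) (ha t)).toLp 2 volume) t := by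
  have ca : Continuous a := continuous_iff_continuousAt.mpr fun s => (hda s).continuousAt
  have cb : Continuous b := continuous_iff_continuousAt.mpr fun s => (hdb s).continuousAt
  have cd : Continuous d := continuous_iff_continuousAt.mpr fun s => (hdd s).continuousAt
  -- The slowest decay is attained at `s₀`; `s₁` supplies a common bound for all other coefficients.
  obtain ⟨s₀, -, hs₀⟩ := (isCompact_closedBall t 1).exists_isMaxOn
    ⟨t, Metric.mem_closedBall_self zero_le_one⟩
    (Complex.continuous_re.comp ca).continuousOn
  obtain ⟨s₁, -, hs₁⟩ := (isCompact_closedBall t 1).exists_isMaxOn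
    ⟨t, Metric.mem_closedBall_self zero_le_one⟩
    (f := fun s => ‖b s‖ + ‖d s‖ + ‖a' s‖ + ‖b' s‖ + ‖d' s‖) (Continuous.continuousOn (by fun_prop))
  set K := ‖b s₁‖ + ‖d s₁‖ + ‖a' s₁‖ + ‖b' s₁‖ + ‖d' s₁‖
  have hδ : 0 < -(a s₀).re := by linarith [ha s₀]
  refine hasDerivAt_toLp_of_dominated
    (f := fun s => gaussianSchwartz c 0 0 1 (a s) (b s) (d s) (ha s))
    (f' := fun s => gaussianSchwartz c (a' s) (b' s) (d' s) (a s) (b s) (d s) (ha s))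
    (fun s => SchwartzMap.memLp _ 2 volume) (SchwartzMap.memLp _ 2 volume)
    ((memLp_exp_neg_mul_sub_sq (half_pos hδ) c).const_mul
      (2 * K * Real.exp (K + (K + 1) ^ 2 / (2 * -(a s₀).re))))
    (fun s x => ?_) (fun s hs x => ?_)
  · simp only [gaussianSchwartz_apply, zero_mul, zero_add, one_mul]
    refine ((((hda s).mul_const _).add ((hdb s).mul_const _)).add (hdd s)).cexp.congr_deriv ?_
    simp only [Pi.add_apply]
    ring
  · have h0 := hs₀ (Metric.ball_subset_closedBall hs)
    have h1 := hs₁ (Metric.ball_subset_closedBall hs)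
    simp only [mem_ofPred_eq, Function.comp_apply] at h0 h1
    have := norm_nonneg (b s)
    have := norm_nonneg (d s)
    have := norm_nonneg (a' s)
    have := norm_nonneg (b' s)
    have := norm_nonneg (d' s)
    refine norm_gaussianSchwartz_le hδ (ha s) (by linarith) ?_ ?_ ?_ ?_ ?_ x <;> linarith

/-! ### Symmetry of the Hamiltonian and conservation of overlaps -/

theorem integral_conj_mul_deriv_deriv (φ g : 𝓢(ℝ, ℂ)) :
    ∫ x, conj (φ x) * deriv (deriv g) x = ∫ x, conj (deriv (deriv φ) x) * g x := by
  set L : ℂ →L[ℝ] ℂ →L[ℝ] ℂ := (ContinuousLinearMap.mul ℝ ℂ).comp Complex.conjCLE.toContinuousLinearMap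
    with hL
  have hLapp (z w : ℂ) : L z w = conj z * w := by simp [hL]
  have h1 := SchwartzMap.integral_bilinear_deriv_right_eq_neg_left φ
    (SchwartzMap.derivCLM ℂ ℂ g) L
  have h2 := SchwartzMap.integral_bilinear_deriv_right_eq_neg_left (SchwartzMap.derivCLM ℂ ℂ φ) g L
  have hφ : ⇑(SchwartzMap.derivCLM ℂ ℂ φ) = deriv φ := rfl
  have hg : ⇑(SchwartzMap.derivCLM ℂ ℂ g) = deriv g := rfl
  rw [hg] at h1
  rw [hφ] at h2
  simp only [hLapp] at h1 h2
  rw [h1, h2, neg_neg]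

theorem integrable_conj_mul_schwartz (φ g : 𝓢(ℝ, ℂ)) : Integrable fun x => conj (φ x) * g x := by
  refine (integrable_conj_mul (φ.toLp 2 volume) (g.toLp 2 volume)).congr ?_
  filter_upwards [φ.coeFn_toLp 2 volume, g.coeFn_toLp 2 volume] with x h1 h2
  rw [h1, h2]

/-- Symmetry of the Hamiltonian on Schwartz functions. -/
theorem integral_conj_hamiltonian_mul (hbar m : ℝ) (V : ℝ → ℝ) (φ g k : 𝓢(ℝ, ℂ))
    (hk : ∀ x, hamiltonian hbar m V g x = k x) :
    ∫ x, conj (hamiltonian hbar m V φ x) * g x = ∫ x, conj (φ x) * k x := by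
  have h (x : ℝ) : conj (hamiltonian hbar m V φ x) * g x = conj (φ x) * k x +
      (-(hbar ^ 2 / (2 * m) : ℝ) * (conj (deriv (deriv φ) x) * g x) -
        -(hbar ^ 2 / (2 * m) : ℝ) * (conj (φ x) * deriv (deriv g) x)) := by
    rw [← hk x, hamiltonian, hamiltonian]
    simp only [map_add, map_mul, map_neg, Complex.conj_ofReal]
    ring
  have i1 := integrable_conj_mul_schwartz φ k
  have i2 : Integrable fun x => (-(hbar ^ 2 / (2 * m) : ℝ) : ℂ) *
      (conj (deriv (deriv φ) x) * g x) :=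
    (integrable_conj_mul_schwartz
      (SchwartzMap.derivCLM ℂ ℂ (SchwartzMap.derivCLM ℂ ℂ φ)) g).const_mul _
  have i3 : Integrable fun x => (-(hbar ^ 2 / (2 * m) : ℝ) : ℂ) *
      (conj (φ x) * deriv (deriv g) x) :=
    (integrable_conj_mul_schwartz φ
      (SchwartzMap.derivCLM ℂ ℂ (SchwartzMap.derivCLM ℂ ℂ g))).const_mul _
  simp only [h]
  rw [integral_add i1 (by exact i2.sub i3), integral_sub i2 i3, integral_const_mul, integral_const_mul,
    integral_conj_mul_deriv_deriv, sub_self, add_zero]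

theorem integral_conj_mul_eq_inner (φ : 𝓢(ℝ, ℂ)) (f : LineHilbert) :
    ∫ x, conj (φ x) * f x = ⟪φ.toLp 2 volume, f⟫_ℂ :=
  (inner_toLp_left _ _).symm

/-- A curve of Schwartz functions that is differentiable in `L²` and solves the Schrödinger
equation. -/
structure IsSchwartzSolution (hbar m : ℝ) (V : ℝ → ℝ) (Φ Φ' : ℝ → 𝓢(ℝ, ℂ)) : Prop where
  hasDerivAt : ∀ t,
    HasDerivAt (fun s => (Φ s).toLp 2 (volume : Measure ℝ)) ((Φ' t).toLp 2 volume) t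
  hamiltonian_eq : ∀ t x, hamiltonian hbar m V (Φ t) x = Complex.I * hbar * Φ' t x

namespace IsSchwartzSolution

variable {hbar m : ℝ} {V : ℝ → ℝ} {Φ Φ' : ℝ → 𝓢(ℝ, ℂ)}

/-- Time translation lets the value of a reference solution be prescribed at time `T` instead of
time `0`. -/
theorem comp_sub_const (h : IsSchwartzSolution hbar m V Φ Φ') (T : ℝ) :
    IsSchwartzSolution hbar m V (fun t => Φ (t - T)) (fun t => Φ' (t - T)) where
  hasDerivAt t := (h.hasDerivAt (t - T)).comp_sub_const t T
  hamiltonian_eq t := h.hamiltonian_eq (t - T)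

theorem isSchrodingerEvolution (h : IsSchwartzSolution hbar m V Φ Φ') (hhbar : 0 < hbar)
    (hnorm : ∀ t, ‖(Φ t).toLp 2 (volume : Measure ℝ)‖ = 1) :
    IsSchrodingerEvolution hbar m V (fun t => (Φ t).toLp 2 volume) where
  norm_eq_one := hnorm
  hasDerivAt φ t := by
    simp only [integral_conj_mul_eq_inner]
    have h1 := (hasDerivAt_const t (φ.toLp 2 (volume : Measure ℝ))).inner ℂ (h.hasDerivAt t)
    refine h1.congr_deriv ?_
    have h2 := integral_conj_hamiltonian_mul hbar m V φ (Φ t) ((Complex.I * hbar) • Φ' t)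
      (fun x => h.hamiltonian_eq t x)
    have h3 : ∫ x, conj (hamiltonian hbar m V φ x) * (Φ t).toLp 2 volume x =
        ∫ x, conj (hamiltonian hbar m V φ x) * Φ t x := by
      refine integral_congr_ae ?_
      filter_upwards [(Φ t).coeFn_toLp 2 volume] with x hx
      rw [hx]
    have h4 : ∫ x, conj (φ x) * ((Complex.I * hbar) • Φ' t) x =
        Complex.I * hbar * ⟪φ.toLp 2 volume, (Φ' t).toLp 2 volume⟫_ℂ := by
      rw [← integral_conj_mul_eq_inner, ← integral_const_mul]
      refine integral_congr_ae ?_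
      filter_upwards [(Φ' t).coeFn_toLp 2 volume] with x hx
      rw [hx, _root_.smul_apply, smul_eq_mul]
      ring
    have h5 : (hbar : ℂ) ≠ 0 := by exact_mod_cast hhbar.ne'
    rw [h3, h2, h4, inner_zero_left, add_zero, ← mul_assoc,
      show -(Complex.I / hbar) * (Complex.I * hbar) = 1 by
        field_simp
        simp]
    simp

/-- The overlap of a weak solution with a strong solution is conserved. -/
theorem hasDerivAt_inner (h : IsSchwartzSolution hbar m V Φ Φ') (hhbar : 0 < hbar)
    {ψ : ℝ → LineHilbert} (hψ : IsSchrodingerEvolution hbar m V ψ) (t : ℝ) :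
    HasDerivAt (fun s => ⟪(Φ s).toLp 2 volume, ψ s⟫_ℂ) 0 t := by
  have hweak (φ : 𝓢(ℝ, ℂ)) := hψ.hasDerivAt φ t
  simp only [integral_conj_mul_eq_inner] at hweak
  have hD : -(Complex.I / hbar) * ∫ x, conj (hamiltonian hbar m V (Φ t) x) * ψ t x =
      -⟪(Φ' t).toLp 2 volume, ψ t⟫_ℂ := by
    have h5 : (hbar : ℂ) ≠ 0 := by exact_mod_cast hhbar.ne'
    rw [← integral_conj_mul_eq_inner, ← integral_const_mul, ← integral_neg]
    refine integral_congr_ae (.of_forall fun x => ?_)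
    simp only [h.hamiltonian_eq, map_mul, Complex.conj_I, Complex.conj_ofReal]
    field_simp
    linear_combination (conj (Φ' t x) * ψ t x) * Complex.I_sq
  -- A product rule in which `ψ` is only weakly differentiable. The quotient splits into three
  -- terms: the error in the quotient of `Φ`, controlled by the unit norm of `ψ`; the pairing with
  -- `Φ' t`, by weak continuity; and the frozen test function `Φ t`, by the weak equation.
  have h1 := hasDerivAt_iff_tendsto_slope_zero.mp (hweak (Φ t))
  rw [hD] at h1
  have hshift : Tendsto (fun s : ℝ => t + s) (𝓝[≠] 0) (𝓝 t) := by
    have : Tendsto (fun s : ℝ => t + s) (𝓝 0) (𝓝 (t + 0)) := (continuous_const_add t).tendsto 0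
    rw [add_zero] at this
    exact this.mono_left nhdsWithin_le_nhds
  have h2 : Tendsto (fun s => ⟪(Φ' t).toLp 2 volume, ψ (t + s)⟫_ℂ) (𝓝[≠] 0)
      (𝓝 ⟪(Φ' t).toLp 2 volume, ψ t⟫_ℂ) := (hweak (Φ' t)).continuousAt.tendsto.comp hshift
  have h3 := tendsto_sub_nhds_zero_iff.mpr (hasDerivAt_iff_tendsto_slope_zero.mp (h.hasDerivAt t))
  have h4 : Tendsto (fun s => ⟪s⁻¹ • ((Φ (t + s)).toLp 2 volume - (Φ t).toLp 2 volume) -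
      (Φ' t).toLp 2 volume, ψ (t + s)⟫_ℂ) (𝓝[≠] 0) (𝓝 0) := by
    refine squeeze_zero_norm (fun s => ?_) (tendsto_zero_iff_norm_tendsto_zero.mp h3)
    refine (norm_inner_le_norm _ _).trans_eq ?_
    rw [hψ.norm_eq_one, mul_one]
  rw [hasDerivAt_iff_tendsto_slope_zero]
  have h5 := (h4.add h2).add h1
  rw [zero_add, add_neg_cancel] at h5
  refine h5.congr fun s => ?_
  rw [inner_sub_left, sub_add_cancel, inner_smul_left_eq_smul, inner_sub_left, ← smul_add]
  congr 1
  ring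

theorem inner_eq_inner (h : IsSchwartzSolution hbar m V Φ Φ') (hhbar : 0 < hbar)
    {ψ : ℝ → LineHilbert} (hψ : IsSchrodingerEvolution hbar m V ψ) (s t : ℝ) :
    ⟪(Φ s).toLp 2 volume, ψ s⟫_ℂ = ⟪(Φ t).toLp 2 volume, ψ t⟫_ℂ :=
  is_const_of_deriv_eq_zero (fun s => (h.hasDerivAt_inner hhbar hψ s).differentiableAt)
    (fun s => (h.hasDerivAt_inner hhbar hψ s).deriv) s t

end IsSchwartzSolution

/-! ### Totality of modulated Gaussians -/

-- A smooth compactly supported `g` is the Fourier transform of a Schwartz function, so moving the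
-- transform onto `F` makes `∫ g F` vanish.
open FourierTransform in
theorem ae_eq_zero_of_fourier_eq_zero {F : ℝ → ℂ} (hF : Integrable F) (h : ∀ w : ℝ, 𝓕 F w = 0) :
    ∀ᵐ x, F x = 0 := by
  refine ae_eq_zero_of_integral_contDiff_smul_eq_zero hF.locallyIntegrable fun g hg hgs => ?_
  have hgs' : HasCompactSupport fun x => (g x : ℂ) :=
    hgs.comp_left (g := fun r : ℝ => (r : ℂ)) Complex.ofReal_zero
  set s : 𝓢(ℝ, ℂ) := hgs'.toSchwartzMap (Complex.ofRealCLM.contDiff.comp hg) with hs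
  have hflip := VectorFourier.integral_fourierIntegral_smul_eq_flip (L := innerₗ ℝ)
    Real.continuous_fourierChar continuous_inner (𝓕⁻ s).integrable hF (μ := volume) (ν := volume)
  have hleft : VectorFourier.fourierIntegral Real.fourierChar volume (innerₗ ℝ) (𝓕⁻ s : 𝓢(ℝ, ℂ)) =
      s := by
    change ⇑(𝓕 (𝓕⁻ s : 𝓢(ℝ, ℂ)) : 𝓢(ℝ, ℂ)) = s
    rw [fourier_fourierInv_eq]
  have hright (x : ℝ) :
      VectorFourier.fourierIntegral Real.fourierChar volume (innerₗ ℝ).flip F x = 0 := by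
    simpa using! h x
  rw [hleft] at hflip
  simp only [hright, smul_zero, integral_zero] at hflip
  rw [← hflip]
  refine integral_congr_ae (.of_forall fun x => ?_)
  rfl

/-- Up to a phase caused by the centre `c`, the pairings are the Fourier transform of `f` times a
conjugated Gaussian, and that Gaussian has no zeros. -/
theorem eq_zero_of_inner_gaussianSchwartz_eq_zero (c : ℝ) {a : ℂ} (ha : a.re < 0)
    {f : LineHilbert}
    (h : ∀ ξ : ℝ, ⟪(gaussianSchwartz c 0 0 1 a (Complex.I * ξ) 0 ha).toLp 2 volume, f⟫_ℂ = 0) :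
    f = 0 := by
  have hF : Integrable fun x : ℝ => conj (Complex.exp (a * (x - c) ^ 2)) * f x := by
    refine (integrable_conj_mul ((gaussianSchwartz c 0 0 1 a 0 0 ha).toLp 2 volume) f).congr ?_
    filter_upwards [(gaussianSchwartz c 0 0 1 a 0 0 ha).coeFn_toLp 2 volume] with x hx
    rw [hx, gaussianSchwartz_apply]
    simp
  have hzero := ae_eq_zero_of_fourier_eq_zero hF fun w => ?_
  · rw [Lp.eq_zero_iff_ae_eq_zero]
    filter_upwards [hzero] with x hx
    simpa using hx
  · have hw := h (2 * Real.pi * w)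
    rw [← integral_conj_mul_eq_inner] at hw
    rw [Real.fourier_real_eq_integral_exp_smul,
      ← mul_zero (Complex.exp (-(Complex.I * (2 * Real.pi * w) * c))), ← hw, ← integral_const_mul]
    refine integral_congr_ae (.of_forall fun x => ?_)
    simp only [gaussianSchwartz_apply, ← Complex.exp_conj, smul_eq_mul, zero_mul, zero_add, one_mul,
      add_zero, map_add, map_mul, map_sub, map_pow, Complex.conj_I, Complex.conj_ofReal,
      ← mul_assoc, ← Complex.exp_add]
    congr 2
    push_cast
    ring

/-! ### Explicit Gaussian solutions of the inverted oscillator -/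

/-- The complex solution `cosh κt + i r sinh κt` of `u'' = κ² u`. -/
noncomputable def hyperbolicMode (κ r t : ℝ) : ℂ :=
  (Real.cosh (κ * t) : ℂ) + Complex.I * r * Real.sinh (κ * t)

/-- The derivative of `hyperbolicMode`, divided by `κ`. -/
noncomputable def hyperbolicModeDeriv (κ r t : ℝ) : ℂ :=
  (Real.sinh (κ * t) : ℂ) + Complex.I * r * Real.cosh (κ * t)

theorem hasDerivAt_ofReal_cosh (κ t : ℝ) :
    HasDerivAt (fun s => (Real.cosh (κ * s) : ℂ)) (κ * Real.sinh (κ * t)) t := by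
  have h := ((Real.hasDerivAt_cosh (κ * t)).comp t ((hasDerivAt_id t).const_mul κ)).ofReal_comp
  refine h.congr_deriv ?_
  push_cast
  ring

theorem hasDerivAt_ofReal_sinh (κ t : ℝ) :
    HasDerivAt (fun s => (Real.sinh (κ * s) : ℂ)) (κ * Real.cosh (κ * t)) t := by
  have h := ((Real.hasDerivAt_sinh (κ * t)).comp t ((hasDerivAt_id t).const_mul κ)).ofReal_comp
  refine h.congr_deriv ?_
  push_cast
  ring

theorem hasDerivAt_hyperbolicMode (κ r t : ℝ) :
    HasDerivAt (hyperbolicMode κ r) (κ * hyperbolicModeDeriv κ r t) t := by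
  refine ((hasDerivAt_ofReal_cosh κ t).add
    ((hasDerivAt_ofReal_sinh κ t).const_mul (Complex.I * r))).congr_deriv ?_
  rw [hyperbolicModeDeriv]
  ring

theorem hasDerivAt_hyperbolicModeDeriv (κ r t : ℝ) :
    HasDerivAt (hyperbolicModeDeriv κ r) (κ * hyperbolicMode κ r t) t := by
  refine ((hasDerivAt_ofReal_sinh κ t).add
    ((hasDerivAt_ofReal_cosh κ t).const_mul (Complex.I * r))).congr_deriv ?_
  rw [hyperbolicMode]
  ring

theorem re_hyperbolicMode (κ r t : ℝ) : (hyperbolicMode κ r t).re = Real.cosh (κ * t) := by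
  simp only [hyperbolicMode, mul_assoc, Complex.add_re, Complex.ofReal_re, Complex.I_mul_re,
    ← Complex.ofReal_mul, Complex.ofReal_im, neg_zero, add_zero]

theorem im_hyperbolicMode (κ r t : ℝ) : (hyperbolicMode κ r t).im = r * Real.sinh (κ * t) := by
  simp only [hyperbolicMode, mul_assoc, Complex.add_im, Complex.ofReal_re, Complex.I_mul_im,
    ← Complex.ofReal_mul, Complex.ofReal_im, zero_add]

theorem re_hyperbolicModeDeriv (κ r t : ℝ) :
    (hyperbolicModeDeriv κ r t).re = Real.sinh (κ * t) := by
  simp only [hyperbolicModeDeriv, mul_assoc, Complex.add_re, Complex.ofReal_re, Complex.I_mul_re,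
    ← Complex.ofReal_mul, Complex.ofReal_im, neg_zero, add_zero]

theorem im_hyperbolicModeDeriv (κ r t : ℝ) :
    (hyperbolicModeDeriv κ r t).im = r * Real.cosh (κ * t) := by
  simp only [hyperbolicModeDeriv, mul_assoc, Complex.add_im, Complex.ofReal_re, Complex.I_mul_im,
    ← Complex.ofReal_mul, Complex.ofReal_im, zero_add]

/-- The curve never meets the branch cut, so the principal logarithm in `gaussianConstCoeff` is
differentiable for all times. -/
theorem hyperbolicMode_mem_slitPlane (κ r t : ℝ) : hyperbolicMode κ r t ∈ Complex.slitPlane := by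
  refine Or.inl ?_
  rw [re_hyperbolicMode]
  exact Real.cosh_pos _

theorem hyperbolicMode_ne_zero (κ r t : ℝ) : hyperbolicMode κ r t ≠ 0 :=
  Complex.slitPlane_ne_zero (hyperbolicMode_mem_slitPlane κ r t)

theorem normSq_hyperbolicMode (κ r t : ℝ) : Complex.normSq (hyperbolicMode κ r t) =
    Real.cosh (κ * t) ^ 2 + r ^ 2 * Real.sinh (κ * t) ^ 2 := by
  rw [Complex.normSq_apply, re_hyperbolicMode, im_hyperbolicMode]
  ring

/-- This makes the derivative of `sinh κt / u` equal to `κ / u²`, the source term `b²` in the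
equation for `d` up to a constant. -/
theorem hyperbolicMode_wronskian (κ r t : ℝ) :
    (Real.cosh (κ * t) : ℂ) * hyperbolicMode κ r t -
      (Real.sinh (κ * t) : ℂ) * hyperbolicModeDeriv κ r t = 1 := by
  have h : ((Real.cosh (κ * t) ^ 2 - Real.sinh (κ * t) ^ 2 : ℝ) : ℂ) = 1 := by
    rw [Real.cosh_sq_sub_sinh_sq, Complex.ofReal_one]
  rw [hyperbolicMode, hyperbolicModeDeriv, ← h]
  push_cast
  ring

/-- Quadratic coefficient of a Gaussian solution for the inverted oscillator
`E - (mκ²/2) (x - c)²`. -/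
noncomputable def gaussianQuadCoeff (hbar m κ r t : ℝ) : ℂ :=
  Complex.I * (m * κ / (2 * hbar) : ℝ) * (hyperbolicModeDeriv κ r t / hyperbolicMode κ r t)

/-- Linear coefficient of a Gaussian solution for the inverted oscillator. -/
noncomputable def gaussianLinCoeff (κ r : ℝ) (b₀ : ℂ) (t : ℝ) : ℂ := b₀ / hyperbolicMode κ r t

/-- Constant coefficient of a Gaussian solution for the inverted oscillator. -/
noncomputable def gaussianConstCoeff (hbar m κ r E : ℝ) (b₀ d₀ : ℂ) (t : ℝ) : ℂ :=
  d₀ - 1 / 2 * Complex.log (hyperbolicMode κ r t) +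
    Complex.I * (hbar / (2 * m * κ) : ℝ) * b₀ ^ 2 *
      ((Real.sinh (κ * t) : ℂ) / hyperbolicMode κ r t) - Complex.I * (E / hbar : ℝ) * t

/-- A Riccati equation, linearised because `a` is a multiple of `u'/u` with `u'' = κ² u`. -/
theorem hasDerivAt_gaussianQuadCoeff {hbar m : ℝ} (hhbar : 0 < hbar) (hm : 0 < m) (κ r t : ℝ) :
    HasDerivAt (gaussianQuadCoeff hbar m κ r)
      (2 * Complex.I * hbar / m * gaussianQuadCoeff hbar m κ r t ^ 2 +
        Complex.I * m * κ ^ 2 / (2 * hbar)) t := by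
  have h1 : (hbar : ℂ) ≠ 0 := by exact_mod_cast hhbar.ne'
  have h2 : (m : ℂ) ≠ 0 := by exact_mod_cast hm.ne'
  have hu := hyperbolicMode_ne_zero κ r t
  refine (((hasDerivAt_hyperbolicModeDeriv κ r t).div (hasDerivAt_hyperbolicMode κ r t) hu).const_mul
    (Complex.I * (m * κ / (2 * hbar) : ℝ))).congr_deriv ?_
  rw [gaussianQuadCoeff]
  push_cast
  field_simp
  linear_combination (-(κ : ℂ) ^ 2 * hyperbolicModeDeriv κ r t ^ 2) * Complex.I_sq

theorem hasDerivAt_gaussianLinCoeff {hbar m : ℝ} (hhbar : 0 < hbar) (hm : 0 < m) (κ r : ℝ) (b₀ : ℂ)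
    (t : ℝ) :
    HasDerivAt (gaussianLinCoeff κ r b₀)
      (2 * Complex.I * hbar / m * gaussianQuadCoeff hbar m κ r t * gaussianLinCoeff κ r b₀ t) t := by
  have h1 : (hbar : ℂ) ≠ 0 := by exact_mod_cast hhbar.ne'
  have h2 : (m : ℂ) ≠ 0 := by exact_mod_cast hm.ne'
  have hu := hyperbolicMode_ne_zero κ r t
  refine ((hasDerivAt_const t b₀).div (hasDerivAt_hyperbolicMode κ r t) hu).congr_deriv ?_
  rw [gaussianQuadCoeff, gaussianLinCoeff]
  push_cast
  field_simp
  linear_combination (-(κ : ℂ) * hyperbolicModeDeriv κ r t * b₀) * Complex.I_sq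

theorem hasDerivAt_gaussianConstCoeff {hbar m κ : ℝ} (hhbar : 0 < hbar) (hm : 0 < m) (hκ : 0 < κ)
    (r E : ℝ) (b₀ d₀ : ℂ) (t : ℝ) :
    HasDerivAt (gaussianConstCoeff hbar m κ r E b₀ d₀)
      (Complex.I * hbar / (2 * m) * (2 * gaussianQuadCoeff hbar m κ r t +
        gaussianLinCoeff κ r b₀ t ^ 2) - Complex.I * E / hbar) t := by
  have h1 : (hbar : ℂ) ≠ 0 := by exact_mod_cast hhbar.ne'
  have h2 : (m : ℂ) ≠ 0 := by exact_mod_cast hm.ne'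
  have h3 : (κ : ℂ) ≠ 0 := by exact_mod_cast hκ.ne'
  have hu := hyperbolicMode_ne_zero κ r t
  have hU := hasDerivAt_hyperbolicMode κ r t
  refine ((((hasDerivAt_const t d₀).sub
    ((hU.clog_real (hyperbolicMode_mem_slitPlane κ r t)).const_mul (1 / 2))).add
    (((hasDerivAt_ofReal_sinh κ t).div hU hu).const_mul
      (Complex.I * (hbar / (2 * m * κ) : ℝ) * b₀ ^ 2))).sub
    ((Complex.ofRealCLM.hasDerivAt (x := t)).const_mul
      (Complex.I * (E / hbar : ℝ)))).congr_deriv ?_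
  have hW := hyperbolicMode_wronskian κ r t
  have hW' : (κ : ℂ) * (Real.cosh (κ * t) : ℂ) * hyperbolicMode κ r t -
      (Real.sinh (κ * t) : ℂ) * (κ * hyperbolicModeDeriv κ r t) = κ := by
    linear_combination (κ : ℂ) * hW
  rw [gaussianQuadCoeff, gaussianLinCoeff, hW', Complex.ofRealCLM_apply]
  push_cast
  field_simp
  linear_combination (-(hyperbolicModeDeriv κ r t) * m * hyperbolicMode κ r t * κ * hbar) * Complex.I_sq

theorem re_gaussianQuadCoeff {hbar : ℝ} (hhbar : 0 < hbar) (m κ r t : ℝ) : (gaussianQuadCoeff hbar m κ r t).re =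
    -(m * κ * r / (2 * hbar)) / Complex.normSq (hyperbolicMode κ r t) := by
  have hu : Complex.normSq (hyperbolicMode κ r t) ≠ 0 := by
    rw [Ne, Complex.normSq_eq_zero]
    exact hyperbolicMode_ne_zero κ r t
  have h := Real.cosh_sq_sub_sinh_sq (κ * t)
  rw [gaussianQuadCoeff, mul_assoc, Complex.I_mul_re, Complex.im_ofReal_mul, Complex.div_im,
    re_hyperbolicMode, im_hyperbolicMode, re_hyperbolicModeDeriv, im_hyperbolicModeDeriv]
  field_simp
  linear_combination (-(m * κ * r)) * h

theorem deriv_gaussianSchwartz (c : ℝ) {a : ℂ} (b d : ℂ) (ha : a.re < 0) :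
    deriv (gaussianSchwartz c 0 0 1 a b d ha) =
      fun x : ℝ => (2 * a * (x - c) + b) * gaussianSchwartz c 0 0 1 a b d ha x := by
  funext x
  have h : HasDerivAt (fun x : ℝ => (x : ℂ) - c) 1 x :=
    (Complex.ofRealCLM.hasDerivAt (x := x)).sub_const _
  have h2 := (((h.fun_pow 2).const_mul a).fun_add (h.const_mul b)).add_const d
  have h3 : ⇑(gaussianSchwartz c 0 0 1 a b d ha) =
      fun x : ℝ => Complex.exp (a * (x - c) ^ 2 + b * (x - c) + d) := by
    funext y
    simp [gaussianSchwartz_apply]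
  rw [h3]
  refine h2.cexp.deriv.trans ?_
  push_cast
  ring

theorem deriv_deriv_gaussianSchwartz (c : ℝ) {a : ℂ} (b d : ℂ) (ha : a.re < 0) (x : ℝ) :
    deriv (deriv (gaussianSchwartz c 0 0 1 a b d ha)) x =
      (2 * a + (2 * a * (x - c) + b) ^ 2) * gaussianSchwartz c 0 0 1 a b d ha x := by
  have h : HasDerivAt (fun x : ℝ => 2 * a * ((x : ℂ) - c) + b) (2 * a * 1) x :=
    (((Complex.ofRealCLM.hasDerivAt (x := x)).sub_const _).const_mul _).add_const _
  have h2 := (gaussianSchwartz c 0 0 1 a b d ha).hasDerivAt x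
  rw [deriv_gaussianSchwartz] at h2 ⊢
  rw [(h.fun_mul h2).deriv]
  ring

/-- The Hamiltonian multiplies a Gaussian by a quadratic in `x - c`; its coefficients over `iħ` are
the right-hand sides of the equations for `a`, `b` and `d`. -/
theorem hamiltonian_gaussianSchwartz {hbar m κ c E : ℝ} (hhbar : 0 < hbar) (hm : 0 < m)
    {V : ℝ → ℝ} (hV : ∀ x, V x = E - m * κ ^ 2 / 2 * (x - c) ^ 2) {a : ℂ} (b d : ℂ)
    (ha : a.re < 0) (x : ℝ) :
    hamiltonian hbar m V (gaussianSchwartz c 0 0 1 a b d ha) x = Complex.I * hbar *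
      gaussianSchwartz c (2 * Complex.I * hbar / m * a ^ 2 + Complex.I * m * κ ^ 2 / (2 * hbar))
        (2 * Complex.I * hbar / m * a * b)
        (Complex.I * hbar / (2 * m) * (2 * a + b ^ 2) - Complex.I * E / hbar) a b d ha x := by
  have h1 : (hbar : ℂ) ≠ 0 := by exact_mod_cast hhbar.ne'
  have h2 : (m : ℂ) ≠ 0 := by exact_mod_cast hm.ne'
  rw [hamiltonian, deriv_deriv_gaussianSchwartz, hV]
  simp only [gaussianSchwartz_apply, zero_mul, zero_add, one_mul]
  generalize Complex.exp (a * (x - c) ^ 2 + b * (x - c) + d) = e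
  push_cast
  generalize (x : ℂ) - c = y
  field_simp
  ring_nf
  simp only [Complex.I_sq]
  ring

/-- A Gaussian solution for the inverted oscillator `E - (mκ²/2) (x - c)²`. -/
theorem exists_isSchwartzSolution_gaussian {hbar m κ r c E : ℝ} (hhbar : 0 < hbar) (hm : 0 < m)
    (hκ : 0 < κ) (hr : 0 < r) {V : ℝ → ℝ} (hV : ∀ x, V x = E - m * κ ^ 2 / 2 * (x - c) ^ 2)
    (b₀ d₀ : ℂ) :
    ∃ (ha : ∀ t, (gaussianQuadCoeff hbar m κ r t).re < 0) (Φ' : ℝ → 𝓢(ℝ, ℂ)),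
      IsSchwartzSolution hbar m V (fun t => gaussianSchwartz c 0 0 1 (gaussianQuadCoeff hbar m κ r t)
        (gaussianLinCoeff κ r b₀ t) (gaussianConstCoeff hbar m κ r E b₀ d₀ t) (ha t)) Φ' := by
  have ha (t : ℝ) : (gaussianQuadCoeff hbar m κ r t).re < 0 := by
    have hu := Complex.normSq_pos.mpr (hyperbolicMode_ne_zero κ r t)
    rw [re_gaussianQuadCoeff hhbar, neg_div]
    exact neg_neg_of_pos (by positivity)
  have hda := hasDerivAt_gaussianQuadCoeff hhbar hm κ r
  have hdb := hasDerivAt_gaussianLinCoeff hhbar hm κ r b₀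
  have hdd := hasDerivAt_gaussianConstCoeff hhbar hm hκ r E b₀ d₀
  have ca : Continuous (gaussianQuadCoeff hbar m κ r) :=
    continuous_iff_continuousAt.mpr fun s => (hda s).continuousAt
  have cb : Continuous (gaussianLinCoeff κ r b₀) :=
    continuous_iff_continuousAt.mpr fun s => (hdb s).continuousAt
  exact ⟨ha, _, hasDerivAt_gaussianSchwartz_toLp ha hda hdb hdd (by fun_prop) (by fun_prop)
    (by fun_prop), fun t x => hamiltonian_gaussianSchwartz hhbar hm hV _ _ (ha t) x⟩

/-! ### Uniqueness of the weak evolution -/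

theorem hyperbolicMode_zero (κ r : ℝ) : hyperbolicMode κ r 0 = 1 := by
  simp [hyperbolicMode]

theorem gaussianLinCoeff_zero (κ r : ℝ) (b₀ : ℂ) : gaussianLinCoeff κ r b₀ 0 = b₀ := by
  simp [gaussianLinCoeff, hyperbolicMode_zero]

theorem gaussianConstCoeff_zero (hbar m κ r E : ℝ) (b₀ d₀ : ℂ) :
    gaussianConstCoeff hbar m κ r E b₀ d₀ 0 = d₀ := by
  simp [gaussianConstCoeff, hyperbolicMode_zero]

/-- Overlaps with Gaussian solutions shifted to time `T` are carried back to time `0`, where both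
evolutions agree. Any positive `r` would serve; `1` is taken. -/
theorem IsSchrodingerEvolution.eq_of_eq_zero {hbar m κ c E : ℝ} (hhbar : 0 < hbar) (hm : 0 < m)
    (hκ : 0 < κ) {V : ℝ → ℝ} (hV : ∀ x, V x = E - m * κ ^ 2 / 2 * (x - c) ^ 2)
    {ψ χ : ℝ → LineHilbert} (hψ : IsSchrodingerEvolution hbar m V ψ)
    (hχ : IsSchrodingerEvolution hbar m V χ) (h0 : ψ 0 = χ 0) : ψ = χ := by
  funext T
  have ha : (gaussianQuadCoeff hbar m κ 1 0).re < 0 :=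
    (exists_isSchwartzSolution_gaussian hhbar hm hκ one_pos hV 0 0).choose 0
  rw [← sub_eq_zero]
  refine eq_zero_of_inner_gaussianSchwartz_eq_zero c ha fun ξ => ?_
  obtain ⟨_, Φ', hΦ⟩ := exists_isSchwartzSolution_gaussian hhbar hm hκ one_pos hV (Complex.I * ξ) 0
  have h1 := (hΦ.comp_sub_const T).inner_eq_inner hhbar hψ T 0
  have h2 := (hΦ.comp_sub_const T).inner_eq_inner hhbar hχ T 0
  simp only [sub_self, gaussianLinCoeff_zero, gaussianConstCoeff_zero] at h1 h2
  rw [inner_sub_right, h1, h2, h0, sub_self]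

/-! ### The moving wavepacket: width, centre and normalisation -/

/-- Re-expansion of the exponent around `c + q`. The real parts fix the width, the centre of the
modulus and the normalisation; the imaginary parts are the phases. -/
theorem gaussianWave_eq_exp {σ : ℝ} (hσ : 0 < σ) (c q : ℝ) {a b d : ℂ}
    (ha : a.re = -(1 / (4 * σ ^ 2))) (hb : (b + 2 * a * q).re = 0)
    (hd : (d + b * q + a * q ^ 2).re = -(1 / 4) * Real.log (2 * Real.pi * σ ^ 2)) (x : ℝ) :
    gaussianWave σ (c + q) a.im (b + 2 * a * q).im (d + b * q + a * q ^ 2).im x =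
      Complex.exp (a * (x - c) ^ 2 + b * (x - c) + d) := by
  have hN : 1 / (2 * Real.pi * σ ^ 2) ^ (1 / 4 : ℝ) =
      Real.exp (-(1 / 4) * Real.log (2 * Real.pi * σ ^ 2)) := by
    rw [Real.rpow_def_of_pos (by positivity), one_div, ← Real.exp_neg]
    congr 1
    ring
  have hsplit : a * ((x : ℂ) - c) ^ 2 + b * (x - c) + d =
      a * ((x - (c + q) : ℝ) : ℂ) ^ 2 + (b + 2 * a * q) * ((x - (c + q) : ℝ) : ℂ) +
        (d + b * q + a * q ^ 2) := by
    push_cast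
    ring
  rw [gaussianWave, hN, ← Real.exp_add, Complex.ofReal_exp, ← Complex.exp_add, hsplit]
  generalize b + 2 * a * q = B at *
  generalize d + b * q + a * q ^ 2 = D at *
  congr 1
  apply Complex.ext
  · rw [← Complex.ofReal_pow]
    simp only [Complex.add_re, Complex.ofReal_re, Complex.re_mul_ofReal, Complex.I_re, ha, hb, hd]
    ring
  · rw [← Complex.ofReal_pow]
    simp only [Complex.add_im, Complex.ofReal_im, Complex.im_mul_ofReal, Complex.I_im]
    ring

theorem gaussianPacket_eq_toLp {σ : ℝ} (hσ : 0 < σ) (c q : ℝ) {a b d : ℂ} (ha' : a.re < 0)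
    (ha : a.re = -(1 / (4 * σ ^ 2))) (hb : (b + 2 * a * q).re = 0)
    (hd : (d + b * q + a * q ^ 2).re = -(1 / 4) * Real.log (2 * Real.pi * σ ^ 2)) :
    (gaussianSchwartz c 0 0 1 a b d ha').toLp 2 volume =
      gaussianPacket σ (c + q) a.im (b + 2 * a * q).im (d + b * q + a * q ^ 2).im := by
  rw [gaussianPacket, SchwartzMap.toLp, MemLp.toLp_eq_toLp_iff]
  refine .of_forall fun x => ?_
  rw [gaussianWave_eq_exp hσ c q ha hb hd, gaussianSchwartz_apply]
  simp

/-- The Gaussian solution that starts as a real Gaussian of width `σ₀` centred at `c + y₀`. -/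
theorem exists_gaussianPacket_evolution {hbar m κ σ₀ c E y₀ : ℝ} (hhbar : 0 < hbar) (hm : 0 < m)
    (hκ : 0 < κ) (hσ₀ : 0 < σ₀) {V : ℝ → ℝ} (hV : ∀ x, V x = E - m * κ ^ 2 / 2 * (x - c) ^ 2) :
    ∃ ψ : ℝ → LineHilbert, IsSchrodingerEvolution hbar m V ψ ∧
      ψ 0 = gaussianPacket σ₀ (c + y₀) 0 0 0 ∧
      ∀ t, ∃ α β γ : ℝ, ψ t = gaussianPacket (√(σ₀ ^ 2 * Real.cosh (κ * t) ^ 2 +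
        (hbar / (2 * m * σ₀ * κ)) ^ 2 * Real.sinh (κ * t) ^ 2))
        (c + y₀ * Real.cosh (κ * t)) α β γ := by
  -- Chosen so that the quadratic coefficient at time `0` is `-1/(4σ₀²)`.
  set r := hbar / (2 * m * σ₀ ^ 2 * κ) with hr
  have hr0 : 0 < r := by positivity
  -- `b₀` and `d₀` come from expanding `-(x - c - y₀)²/(4σ₀²)` in `x - c`, with the logarithm of the
  -- normalising factor added to `d₀`.
  set b₀ : ℝ := y₀ / (2 * σ₀ ^ 2) with hb₀
  set d₀ : ℝ := -(y₀ ^ 2 / (4 * σ₀ ^ 2)) - 1 / 4 * Real.log (2 * Real.pi * σ₀ ^ 2) with hd₀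
  obtain ⟨hneg, Φ', hΦ⟩ := exists_isSchwartzSolution_gaussian hhbar hm hκ hr0 hV b₀ d₀
  have hN (t : ℝ) : 0 < Complex.normSq (hyperbolicMode κ r t) :=
    Complex.normSq_pos.mpr (hyperbolicMode_ne_zero κ r t)
  have hσt (t : ℝ) : σ₀ ^ 2 * Real.cosh (κ * t) ^ 2 +
      (hbar / (2 * m * σ₀ * κ)) ^ 2 * Real.sinh (κ * t) ^ 2 =
      σ₀ ^ 2 * Complex.normSq (hyperbolicMode κ r t) := by
    rw [normSq_hyperbolicMode, hr]
    field_simp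
  have hpacket (t : ℝ) := gaussianPacket_eq_toLp
    (σ := √(σ₀ ^ 2 * Complex.normSq (hyperbolicMode κ r t)))
    (Real.sqrt_pos.mpr (mul_pos (by positivity) (hN t))) c (y₀ * Real.cosh (κ * t))
    (b := gaussianLinCoeff κ r b₀ t) (d := gaussianConstCoeff hbar m κ r E b₀ d₀ t) (hneg t)
    (by
      have := (hN t).ne'
      rw [Real.sq_sqrt (by have := hN t; positivity), re_gaussianQuadCoeff hhbar, hr]
      field_simp
      norm_num)
    (by
      have := (hN t).ne'
      rw [Complex.add_re, Complex.re_mul_ofReal, show (2 : ℂ) = ((2 : ℝ) : ℂ) by simp,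
        Complex.re_ofReal_mul, re_gaussianQuadCoeff hhbar, gaussianLinCoeff, Complex.div_re,
        re_hyperbolicMode, Complex.ofReal_re, Complex.ofReal_im, hr, hb₀]
      field_simp
      ring)
    (by
      have hN' := (hN t).ne'
      have hlog : (Complex.log (hyperbolicMode κ r t)).re =
          1 / 2 * Real.log (Complex.normSq (hyperbolicMode κ r t)) := by
        rw [Complex.log_re, Complex.normSq_eq_norm_sq, Real.log_pow]
        push_cast
        ring
      have hsplit : gaussianConstCoeff hbar m κ r E b₀ d₀ t =
          (d₀ : ℂ) - ((1 / 2 : ℝ) : ℂ) * Complex.log (hyperbolicMode κ r t) +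
            Complex.I * ((hbar / (2 * m * κ) * b₀ ^ 2 * Real.sinh (κ * t) : ℝ) *
              (hyperbolicMode κ r t)⁻¹) - Complex.I * (E / hbar * t : ℝ) := by
        rw [gaussianConstCoeff]
        push_cast
        ring
      have hNval := normSq_hyperbolicMode κ r t
      -- The displacement terms of the real part at the moving centre add up to a constant, because
      -- `|u|² = cosh² + r² sinh²`; it cancels the `y₀²` term of `d₀`.
      have hinner : hbar / (2 * m * κ) * b₀ ^ 2 * Real.sinh (κ * t) *
          (r * Real.sinh (κ * t) / Complex.normSq (hyperbolicMode κ r t)) +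
          b₀ * (Real.cosh (κ * t) / Complex.normSq (hyperbolicMode κ r t)) *
            (y₀ * Real.cosh (κ * t)) +
          -(m * κ * r / (2 * hbar)) / Complex.normSq (hyperbolicMode κ r t) *
            (y₀ * Real.cosh (κ * t)) ^ 2 = y₀ ^ 2 / (4 * σ₀ ^ 2) := by
        have hmr : m * κ * r / (2 * hbar) = 1 / (4 * σ₀ ^ 2) := by
          rw [hr]
          field_simp
          norm_num
        have hkr : hbar / (2 * m * κ) = r * σ₀ ^ 2 := by
          rw [hr]
          field_simp
        rw [hmr, hkr, hb₀]
        field_simp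
        rw [hNval]
        ring
      rw [Real.sq_sqrt (by have := hN t; positivity), ← mul_assoc,
        Real.log_mul (by positivity) hN', ← Complex.ofReal_pow, Complex.add_re, Complex.add_re,
        Complex.re_mul_ofReal, Complex.re_mul_ofReal, re_gaussianQuadCoeff hhbar, gaussianLinCoeff,
        div_eq_mul_inv, Complex.re_ofReal_mul, hsplit, Complex.sub_re, Complex.add_re,
        Complex.sub_re, Complex.re_ofReal_mul, hlog, Complex.I_mul_re, Complex.I_mul_re,
        Complex.im_ofReal_mul, Complex.inv_im, Complex.inv_re, im_hyperbolicMode,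
        re_hyperbolicMode, Complex.ofReal_re, Complex.ofReal_im, hd₀]
      linear_combination hinner)
  refine ⟨_, hΦ.isSchrodingerEvolution hhbar fun t => ?_, ?_, fun t => ?_⟩
  · rw [hpacket]
    exact norm_gaussianPacket (Real.sqrt_pos.mpr (mul_pos (by positivity) (hN t))) _ _ _ _
  · have h0 := hpacket 0
    have hq : gaussianQuadCoeff hbar m κ r 0 = ((-(m * κ / (2 * hbar) * r) : ℝ) : ℂ) := by
      rw [gaussianQuadCoeff, hyperbolicMode_zero, hyperbolicModeDeriv]
      push_cast
      simp only [mul_zero, Complex.sinh_zero, Complex.cosh_zero]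
      linear_combination ((m : ℂ) * κ / (2 * hbar) * r) * Complex.I_sq
    have h1 : (gaussianQuadCoeff hbar m κ r 0).im = 0 := by rw [hq, Complex.ofReal_im]
    rw [h0]
    simp only [gaussianLinCoeff_zero, gaussianConstCoeff_zero, hyperbolicMode_zero, mul_zero,
      Real.cosh_zero, mul_one, map_one, Real.sqrt_sq hσ₀.le]
    congr 1
    · rw [hq]
      norm_cast
    · rw [hq]
      norm_cast
  · exact ⟨_, _, _, by rw [hσt]; exact hpacket t⟩

/-! ### The Newtonian potential and the main theorem -/

/-- Completing the square: `V'(x₀) = GmM/x₀²` and `V''(x₀) = -2GmM/x₀³ = -mκ²` put the vertex at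
distance `-V'/V'' = x₀/2` from `x₀`. -/
theorem quadraticApprox_newtonPotential {G m M x₀ : ℝ} (hG : 0 < G) (hM : 0 < M)
    (hx₀ : 0 < x₀) (x : ℝ) :
    quadraticApprox (newtonPotential G m M) x₀ x =
      -(G * m * M / x₀) + m * newtonRate G M x₀ ^ 2 / 2 * (x₀ / 2) ^ 2 -
        m * newtonRate G M x₀ ^ 2 / 2 * (x - (x₀ + x₀ / 2)) ^ 2 := by
  have h1 (y : ℝ) (hy : y ≠ 0) : HasDerivAt (newtonPotential G m M) (G * m * M * (y ^ 2)⁻¹) y := by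
    refine ((hasDerivAt_inv hy).const_mul (-(G * m * M))).congr_deriv ?_ |>.congr_of_eventuallyEq ?_
    · ring
    · exact .of_forall fun z => by simp only [newtonPotential]; ring
  have h2 : HasDerivAt (deriv (newtonPotential G m M)) (-(2 * G * m * M / x₀ ^ 3)) x₀ := by
    have h3 : deriv (newtonPotential G m M) =ᶠ[𝓝 x₀] fun y => G * m * M * (y ^ 2)⁻¹ := by
      filter_upwards [isOpen_ne.mem_nhds hx₀.ne'] with y hy using (h1 y hy).deriv
    refine HasDerivAt.congr_of_eventuallyEq ?_ h3
    refine (((hasDerivAt_pow 2 x₀).inv (by positivity)).const_mul (G * m * M)).congr_deriv ?_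
    field_simp
    ring
  have hκ : newtonRate G M x₀ ^ 2 = 2 * G * M / x₀ ^ 3 := Real.sq_sqrt (by positivity)
  rw [quadraticApprox, h2.deriv, (h1 x₀ hx₀.ne').deriv, hκ, newtonPotential]
  field_simp
  ring

theorem newtonRate_pos {G M x₀ : ℝ} (hG : 0 < G) (hM : 0 < M) (hx₀ : 0 < x₀) :
    0 < newtonRate G M x₀ := Real.sqrt_pos.mpr (by positivity)

theorem newtonWidth_pos (hbar : ℝ) (G m M x₀ : ℝ) {σ₀ : ℝ} (hσ₀ : 0 < σ₀) (t : ℝ) :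
    0 < newtonWidth hbar G m M x₀ σ₀ t := by
  have := Real.cosh_pos (newtonRate G M x₀ * t)
  exact Real.sqrt_pos.mpr (by positivity)

theorem strictMonoOn_newtonWidth_sq (hbar : ℝ) {G M x₀ σ₀ : ℝ} (m : ℝ) (hG : 0 < G) (hM : 0 < M)
    (hx₀ : 0 < x₀) (hσ₀ : 0 < σ₀) :
    StrictMonoOn (fun t => newtonWidth hbar G m M x₀ σ₀ t ^ 2) (Ici 0) := by
  intro s hs t ht hst
  have hκ := newtonRate_pos hG hM hx₀
  have hs0 : 0 ≤ newtonRate G M x₀ * s := mul_nonneg hκ.le hs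
  have hlt : newtonRate G M x₀ * s < newtonRate G M x₀ * t := mul_lt_mul_of_pos_left hst hκ
  have hcosh := Real.cosh_strictMonoOn hs0 (hs0.trans hlt.le) hlt
  have hsinh := Real.sinh_lt_sinh.mpr hlt
  have hsinh0 := Real.sinh_nonneg_iff.mpr hs0
  have hcosh0 := Real.cosh_pos (newtonRate G M x₀ * s)
  simp only [newtonWidth]
  rw [Real.sq_sqrt (by positivity), Real.sq_sqrt (by positivity)]
  have h1 : σ₀ ^ 2 * Real.cosh (newtonRate G M x₀ * s) ^ 2 <
      σ₀ ^ 2 * Real.cosh (newtonRate G M x₀ * t) ^ 2 := by gcongr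
  have h2 : (hbar / (2 * m * σ₀ * newtonRate G M x₀)) ^ 2 *
      Real.sinh (newtonRate G M x₀ * s) ^ 2 ≤ (hbar / (2 * m * σ₀ * newtonRate G M x₀)) ^ 2 *
      Real.sinh (newtonRate G M x₀ * t) ^ 2 := by gcongr
  exact add_lt_add_of_lt_of_le h1 h2

theorem mainTheorem10 (hbar : ℝ) (hhbar : 0 < hbar) :
    -- the channel multiplies position kernels by the Gaussian kernel
    (∀ ℓ : ℝ, 0 < ℓ → ∀ ψ φ : LineHilbert,
      gaussianDephasing hbar ℓ (pureState ψ) φ =ᵐ[volume]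
        fun x => ∫ y, (gaussianKernel ℓ (x - y) : ℂ) * (ψ x * conj (ψ y)) * φ y) ∧
    -- value of the loss on Gaussian wavepackets
    (∀ ℓ σ c α β γ : ℝ, 0 < ℓ → 0 < σ →
      l2DephasingLoss (gaussianDephasing hbar ℓ) (pureState (gaussianPacket σ c α β γ)) =
        1 - 1 / √(1 + 4 * σ ^ 2 / ℓ ^ 2)) ∧
    -- strict monotonicity in `σ / ℓ`
    (∀ ℓ σ c α β γ ℓ' σ' c' α' β' γ' : ℝ, 0 < ℓ → 0 < σ → 0 < ℓ' → 0 < σ' → σ / ℓ < σ' / ℓ' →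
      l2DephasingLoss (gaussianDephasing hbar ℓ) (pureState (gaussianPacket σ c α β γ)) <
        l2DephasingLoss (gaussianDephasing hbar ℓ')
          (pureState (gaussianPacket σ' c' α' β' γ'))) ∧
    -- limits `σ / ℓ → 0` and `σ / ℓ → ∞`
    (∀ ℓ σ c α β γ : ℕ → ℝ, (∀ n, 0 < ℓ n) → (∀ n, 0 < σ n) →
      (Tendsto (fun n => σ n / ℓ n) atTop (𝓝 0) →
        Tendsto (fun n => l2DephasingLoss (gaussianDephasing hbar (ℓ n))
          (pureState (gaussianPacket (σ n) (c n) (α n) (β n) (γ n)))) atTop (𝓝 0)) ∧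
      (Tendsto (fun n => σ n / ℓ n) atTop atTop →
        Tendsto (fun n => l2DephasingLoss (gaussianDephasing hbar (ℓ n))
          (pureState (gaussianPacket (σ n) (c n) (α n) (β n) (γ n)))) atTop (𝓝 1))) ∧
    -- evolution in the quadratic approximation of the Newtonian potential
    (∀ G m M x₀ σ₀ : ℝ, 0 < G → 0 < m → 0 < M → 0 < x₀ → 0 < σ₀ →
      (∃! ψ : ℝ → LineHilbert,
        IsSchrodingerEvolution hbar m (quadraticApprox (newtonPotential G m M) x₀) ψ ∧
          ψ 0 = gaussianPacket σ₀ x₀ 0 0 0) ∧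
      ∀ ψ : ℝ → LineHilbert,
        IsSchrodingerEvolution hbar m (quadraticApprox (newtonPotential G m M) x₀) ψ →
        ψ 0 = gaussianPacket σ₀ x₀ 0 0 0 →
        (∀ t : ℝ, ∃ α β γ : ℝ,
          ψ t = gaussianPacket (newtonWidth hbar G m M x₀ σ₀ t) (newtonCenter G M x₀ t) α β γ) ∧
        ∀ ℓ : ℝ, 0 < ℓ →
          (∀ t : ℝ, l2DephasingLoss (gaussianDephasing hbar ℓ) (pureState (ψ t)) =
            1 - 1 / √(1 + 4 * newtonWidth hbar G m M x₀ σ₀ t ^ 2 / ℓ ^ 2)) ∧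
          StrictMonoOn
            (fun t => l2DephasingLoss (gaussianDephasing hbar ℓ) (pureState (ψ t))) (Ici 0)) := by
  refine ⟨fun ℓ hℓ ψ φ => gaussianDephasing_pureState_apply hhbar hℓ ψ φ,
    fun ℓ σ c α β γ hℓ hσ => l2DephasingLoss_gaussianPacket hhbar hℓ hσ c α β γ,
    fun ℓ σ c α β γ ℓ' σ' c' α' β' γ' hℓ hσ hℓ' hσ' h => ?_, fun ℓ σ c α β γ hℓ hσ => ?_,
    fun G m M x₀ σ₀ hG hm hM hx₀ hσ₀ => ?_⟩
  · rw [l2DephasingLoss_gaussianPacket hhbar hℓ hσ, l2DephasingLoss_gaussianPacket hhbar hℓ' hσ',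
      mul_div_assoc, mul_div_assoc, ← div_pow, ← div_pow]
    exact gaussianLoss_lt (by positivity) (by gcongr)
  · have h (n : ℕ) := l2DephasingLoss_gaussianPacket hhbar (hℓ n) (hσ n) (c n) (α n) (β n) (γ n)
    simp only [mul_div_assoc, ← div_pow] at h
    simp only [h]
    exact ⟨tendsto_gaussianLoss_zero, tendsto_gaussianLoss_one⟩
  · have hκ := newtonRate_pos hG hM hx₀
    have hV := quadraticApprox_newtonPotential (m := m) hG hM hx₀
    -- Seen from the vertex `x₀ + x₀/2`, the initial centre `x₀` is displaced by `-x₀/2`.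
    obtain ⟨χ, hχ, hχ0, hχt⟩ :=
      exists_gaussianPacket_evolution (y₀ := -(x₀ / 2)) hhbar hm hκ hσ₀ hV
    rw [add_neg_cancel_right] at hχ0
    refine ⟨⟨χ, ⟨hχ, hχ0⟩, fun ψ hψ => hψ.1.eq_of_eq_zero hhbar hm hκ hV hχ (hψ.2.trans hχ0.symm)⟩,
      fun ψ hψ hψ0 => ?_⟩
    have hψt (t : ℝ) : ∃ α β γ : ℝ,
        ψ t = gaussianPacket (newtonWidth hbar G m M x₀ σ₀ t) (newtonCenter G M x₀ t) α β γ := by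
      rw [hψ.eq_of_eq_zero hhbar hm hκ hV hχ (hψ0.trans hχ0.symm)]
      obtain ⟨α, β, γ, h⟩ := hχt t
      refine ⟨α, β, γ, h.trans ?_⟩
      rw [newtonWidth, newtonCenter]
      congr 1
      ring
    refine ⟨hψt, fun ℓ hℓ => ?_⟩
    have hloss (t : ℝ) : l2DephasingLoss (gaussianDephasing hbar ℓ) (pureState (ψ t)) =
        1 - 1 / √(1 + 4 * newtonWidth hbar G m M x₀ σ₀ t ^ 2 / ℓ ^ 2) := by
      obtain ⟨α, β, γ, h⟩ := hψt t
      rw [h, l2DephasingLoss_gaussianPacket hhbar hℓ (newtonWidth_pos hbar G m M x₀ hσ₀ t)]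
    refine ⟨hloss, fun s hs t ht hst => ?_⟩
    have hw := strictMonoOn_newtonWidth_sq hbar m hG hM hx₀ hσ₀ hs ht hst
    simp only [hloss, mul_div_assoc]
    exact gaussianLoss_lt (by positivity) (by gcongr)
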